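/- Let $M_{KT}=\mathbb R^4/\Gamma$ be the Kodaira–Thurston manifold, where $\Gamma$ is the group generated by $(x,y,z,t)\mapsto(x+1,y,z+y,t)$, $(x,y+1,z,t)$, $(x,y,z+1,t)$, $(x,y,z,t+1)$. For $k\in\mathbb N$ and $\operatorname{Im}\tau>0$, a theta function of degree $k$ is an entire function $f$ with $f(z+1)=f(z)$ and $f(z+\tau)=e^{-2\pi i k z}f(z)$. Let $k\ge 3$ and let $\theta_k^1(z,\tau),\dots,\theta_k^k(z,\tau)$ be functions on $\mathbb C\times\{\operatorname{Im}\tau>0\}$, smooth in $(z,\tau)$ and invariant under $\tau\mapsto\tau+1$, which for each $\tau$ form a basis of the space of theta functions of degree $k$. Such functions exist: the classical series $$\sum_{m\in\mathbb Z}\exp\bigl(2\pi i(p+km)z+\pi i(2pm+km(m-1))\tau\bigr),\qquad p=0,\dots,k-1,$$ have these properties. Let $\mathcal L_k$ be the complex vector space of functions on $\mathbb R^4$ spanned by the products $$\theta_k^p(z+ix,\,y+i)\cdot\theta_k^q(y+it,\,i),\qquad p,q=1,\dots,k.$$ Then $\dim\mathcal L_k=k^2$, and for every basis $s_1,\dots,s_{k^2}$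 of $\mathcal L_k$ the map $$\varphi_k:M_{KT}\to\mathbb{CP}^{k^2-1},\qquad \varphi_k(x,y,z,t)=[s_1(x,y,z,t):\dots:s_{k^2}(x,y,z,t)],$$ is well defined (in particular the $s_i$ have no common zero) and is a smooth embedding, i.e. a smooth map that is a homeomorphism onto its image and whose differential is injective at every point. -/

import Mathlib

open scoped Manifold ContDiff Topology

namespace KodairaThurston

noncomputable section

/-! ### The Kodaira-Thurston manifold -/

/-- `ℝ⁴`, with coordinates `(x, y, z, t) = (u 0, u 1, u 2, u 3)`. -/
abbrev R4 : Type := EuclideanSpace ℝ (Fin 4)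

/-- `a : (x, y, z, t) ↦ (x + 1, y, z + y, t)`. -/
def genA : Equiv.Perm R4 where
  toFun u := !₂[u 0 + 1, u 1, u 2 + u 1, u 3]
  invFun u := !₂[u 0 - 1, u 1, u 2 - u 1, u 3]
  left_inv u := by ext i; fin_cases i <;> simp
  right_inv u := by ext i; fin_cases i <;> simp

/-- `b : (x, y, z, t) ↦ (x, y + 1, z, t)`. -/
def genB : Equiv.Perm R4 where
  toFun u := !₂[u 0, u 1 + 1, u 2, u 3]
  invFun u := !₂[u 0, u 1 - 1, u 2, u 3]
  left_inv u := by ext i; fin_cases i <;> simp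
  right_inv u := by ext i; fin_cases i <;> simp

/-- `c : (x, y, z, t) ↦ (x, y, z + 1, t)`. -/
def genC : Equiv.Perm R4 where
  toFun u := !₂[u 0, u 1, u 2 + 1, u 3]
  invFun u := !₂[u 0, u 1, u 2 - 1, u 3]
  left_inv u := by ext i; fin_cases i <;> simp
  right_inv u := by ext i; fin_cases i <;> simp

/-- `d : (x, y, z, t) ↦ (x, y, z, t + 1)`. -/
def genD : Equiv.Perm R4 where
  toFun u := !₂[u 0, u 1, u 2, u 3 + 1]
  invFun u := !₂[u 0, u 1, u 2, u 3 - 1]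
  left_inv u := by ext i; fin_cases i <;> simp
  right_inv u := by ext i; fin_cases i <;> simp

/-- The discrete group `Γ` of transformations of `ℝ⁴` generated by `a`, `b`, `c`, `d`. -/
def Gam : Subgroup (Equiv.Perm R4) := Subgroup.closure {genA, genB, genC, genD}

/-- The general element of `Γ`, as a map. -/
def gamFun (q : ℤ × ℤ × ℤ × ℤ) (u : R4) : R4 :=
  !₂[u 0 + q.1, u 1 + q.2.1, u 2 + q.2.2.1 + q.1 * u 1, u 3 + q.2.2.2]

theorem exists_gamFun (g : Equiv.Perm R4) (hg : g ∈ Gam) : ∃ q, ∀ u, g u = gamFun q u := by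
  induction hg using Subgroup.closure_induction with
  | mem g hg =>
    rcases hg with rfl | rfl | rfl | rfl
    · refine ⟨(1, 0, 0, 0), fun u => ?_⟩
      ext i; fin_cases i <;> simp [genA, gamFun]
    · refine ⟨(0, 1, 0, 0), fun u => ?_⟩
      ext i; fin_cases i <;> simp [genB, gamFun]
    · refine ⟨(0, 0, 1, 0), fun u => ?_⟩
      ext i; fin_cases i <;> simp [genC, gamFun]
    · refine ⟨(0, 0, 0, 1), fun u => ?_⟩
      ext i; fin_cases i <;> simp [genD, gamFun]
  | one =>
    refine ⟨(0, 0, 0, 0), fun u => ?_⟩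
    ext i; fin_cases i <;> simp [gamFun]
  | mul g h _ _ hg hh =>
    obtain ⟨⟨l, m, n, p⟩, hg⟩ := hg
    obtain ⟨⟨l', m', n', p'⟩, hh⟩ := hh
    refine ⟨(l + l', m + m', n + n' + l * m', p + p'), fun u => ?_⟩
    rw [Equiv.Perm.mul_apply, hh, hg]
    ext i; fin_cases i <;> simp [gamFun] <;> ring
  | inv g _ hg =>
    obtain ⟨⟨l, m, n, p⟩, hg⟩ := hg
    refine ⟨(-l, -m, -n + l * m, -p), fun u => ?_⟩
    rw [Equiv.Perm.inv_eq_iff_eq, hg]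
    ext i; fin_cases i <;> simp [gamFun]; ring

instance instContinuousConstSMulGam : ContinuousConstSMul Gam R4 where
  continuous_const_smul g := by
    obtain ⟨q, hq⟩ := exists_gamFun g.1 g.2
    have h : (fun u : R4 => g • u) = gamFun q := funext hq
    rw [h]
    refine (PiLp.continuous_toLp 2 _).comp (continuous_pi fun i => ?_)
    fin_cases i <;> simp <;> fun_prop

instance instIsCancelSMulGam : IsCancelSMul Gam R4 where
  right_cancel' g h u hgh := by
    obtain ⟨⟨l, m, n, p⟩, hg⟩ := exists_gamFun g.1 g.2
    obtain ⟨⟨l', m', n', p'⟩, hh⟩ := exists_gamFun h.1 h.2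
    have key : gamFun (l, m, n, p) u = gamFun (l', m', n', p') u :=
      (hg u).symm.trans (Eq.trans hgh (hh u))
    have h0 := congrArg (fun v : R4 => v 0) key
    have h1 := congrArg (fun v : R4 => v 1) key
    have h2 := congrArg (fun v : R4 => v 2) key
    have h3 := congrArg (fun v : R4 => v 3) key
    simp [gamFun] at h0 h1 h2 h3
    subst h0 h1 h3
    simp at h2
    subst h2
    exact Subtype.ext (Equiv.ext fun w => (hg w).trans (hh w).symm)

instance instProperlyDiscontinuousSMulGam : ProperlyDiscontinuousSMul Gam R4 where
  finite_disjoint_inter_image {K L} hK hL := by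
    obtain ⟨R, hR⟩ := (hK.union hL).isBounded.exists_norm_le
    have hc : ∀ u ∈ K ∪ L, ∀ i, |u i| ≤ R := fun u hu i =>
      (PiLp.norm_apply_le u i).trans (hR u hu)
    obtain ⟨N, hN⟩ := exists_nat_ge (2 * R + 2 * R * R)
    obtain ⟨N', hN'⟩ := exists_nat_ge (2 * R)
    set B : Set (ℤ × ℤ × ℤ × ℤ) :=
      Set.Icc (-(N' : ℤ)) N' ×ˢ Set.Icc (-(N' : ℤ)) N' ×ˢ Set.Icc (-(N : ℤ)) N ×ˢ
        Set.Icc (-(N' : ℤ)) N'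
    have hB : B.Finite := (Set.finite_Icc _ _).prod ((Set.finite_Icc _ _).prod
      ((Set.finite_Icc _ _).prod (Set.finite_Icc _ _)))
    refine Set.Finite.subset ((hB.image gamFun).preimage
      (f := fun g : Gam => fun u : R4 => g.1 u) ?_) ?_
    · intro g _ h _ hgh
      exact Subtype.ext (Equiv.ext fun w => congrFun hgh w)
    · rintro g ⟨_, ⟨u, hu, rfl⟩, hv⟩
      obtain ⟨⟨l, m, n, p⟩, hg⟩ := exists_gamFun g.1 g.2
      refine ⟨(l, m, n, p), ?_, funext fun w => (hg w).symm⟩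
      have hv' : gamFun (l, m, n, p) u ∈ L := (hg u) ▸ hv
      have hu0 := abs_le.1 (hc u (Or.inl hu) 0)
      have hu1 := abs_le.1 (hc u (Or.inl hu) 1)
      have hu2 := abs_le.1 (hc u (Or.inl hu) 2)
      have hu3 := abs_le.1 (hc u (Or.inl hu) 3)
      have hv0 := abs_le.1 (hc _ (Or.inr hv') 0)
      have hv1 := abs_le.1 (hc _ (Or.inr hv') 1)
      have hv2 := abs_le.1 (hc _ (Or.inr hv') 2)
      have hv3 := abs_le.1 (hc _ (Or.inr hv') 3)
      simp [gamFun] at hv0 hv1 hv2 hv3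
      have hl : |(l : ℝ)| ≤ 2 * R := abs_le.2 ⟨by linarith, by linarith⟩
      have hlu : |(l : ℝ) * u 1| ≤ 2 * R * R := by
        rw [abs_mul]
        exact mul_le_mul hl (abs_le.2 hu1) (abs_nonneg _) (by linarith)
      have hlu' := abs_le.1 hlu
      refine ⟨⟨?_, ?_⟩, ⟨?_, ?_⟩, ⟨?_, ?_⟩, ⟨?_, ?_⟩⟩ <;> rify <;> linarith

/-- The Kodaira-Thurston manifold `M_KT = ℝ⁴ / Γ`. -/
abbrev MKT : Type := MulAction.orbitRel.Quotient Gam R4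

/-- The projection `ℝ⁴ → M_KT`. -/
def proj (u : R4) : MKT := Quotient.mk _ u

theorem contDiff_smul_gam (g : Gam) : ContDiff ℝ ∞ (fun u : R4 => g • u) := by
  obtain ⟨q, hq⟩ := exists_gamFun g.1 g.2
  have h : (fun u : R4 => g • u) = gamFun q := funext hq
  rw [h]
  refine (contDiff_piLp 2).2 fun i => ?_
  fin_cases i <;> simp [gamFun] <;> fun_prop

instance instIsManifoldMKT : IsManifold 𝓘(ℝ, R4) ∞ MKT := by
  refine isManifold_of_contDiffOn _ _ _ ?_
  rintro _ _ ⟨p, rfl⟩ ⟨q, rfl⟩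
  simp only [chartAt_self_eq, OpenPartialHomeomorph.trans_refl, modelWithCornersSelf_coe,
    modelWithCornersSelf_coe_symm, Set.range_id, Set.inter_univ, Function.id_comp,
    Function.comp_id, Set.preimage_id]
  set hloc := (isQuotientCoveringMap_quotientMk_of_properlyDiscontinuousSMul
    (E := R4) (G := Gam)).isCoveringMap.isLocalHomeomorph
  set e := hloc.localInverseAt
    ((Quotient.mk_surjective (s := MulAction.orbitRel Gam R4)).hasRightInverse.choose p)
  set e' := hloc.localInverseAt
    ((Quotient.mk_surjective (s := MulAction.orbitRel Gam R4)).hasRightInverse.choose q)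
  have he : (e.symm : R4 → MKT) = proj := hloc.localInverseAt_symm _
  have he' : (e'.symm : R4 → MKT) = proj := hloc.localInverseAt_symm _
  have hinv : ∀ (g : Gam) (w : R4), proj (g • w) = proj w := fun g w =>
    Quotient.sound (MulAction.mem_orbit w g)
  intro w hw
  have hw' : proj w ∈ e'.source := by
    have h2 : e.symm w ∈ e'.source := hw.2
    rwa [he] at h2
  have hpr : proj (e' (proj w)) = proj w := by
    rw [← he']; simpa [he'] using e'.left_inv hw'
  obtain ⟨g, hg⟩ : ∃ g : Gam, g • w = e' (proj w) := Quotient.exact hpr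
  have hopen : ∀ᶠ v in 𝓝 w, g • v ∈ e'.target :=
    (continuous_const_smul g).continuousAt.eventually
      (e'.open_target.mem_nhds (by
        change g • w ∈ e'.target
        rw [hg]; exact e'.map_source hw'))
  refine ContDiffAt.contDiffWithinAt
    ((contDiff_smul_gam g).contDiffAt.congr_of_eventuallyEq ?_)
  filter_upwards [hopen] with v hv
  have := e'.right_inv hv
  rw [he', hinv] at this
  change e' (e.symm v) = g • v
  rw [he, this]

/-! ### Complex projective space as a smooth real manifold -/

open scoped LinearAlgebra.Projectivization

/-- Complex projective space `ℂPⁿ`, with homogeneous coordinates indexed by `0, …, n`. -/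
abbrev CP (n : ℕ) : Type := ℙ ℂ (Fin (n + 1) → ℂ)

/-- The quotient topology. -/
instance instTopologicalSpaceCP (n : ℕ) : TopologicalSpace (CP n) :=
  inferInstanceAs (TopologicalSpace (Quotient (projectivizationSetoid ℂ (Fin (n + 1) → ℂ))))

theorem isQuotientMap_mk' (n : ℕ) :
    Topology.IsQuotientMap (Projectivization.mk' ℂ : {v : Fin (n + 1) → ℂ // v ≠ 0} → CP n) :=
  isQuotientMap_quotient_mk'

/-- Affine coordinates `(v j / v i)`, `j ≠ i`. -/
def affineCoord {n : ℕ} (i : Fin (n + 1)) : CP n → (Fin n → ℂ) :=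
  Projectivization.lift (fun (v : {v : Fin (n + 1) → ℂ // v ≠ 0}) j => v.1 (i.succAbove j) / v.1 i) (by
    rintro ⟨a, ha⟩ ⟨b, hb⟩ t (h : a = t • b)
    have ht : t ≠ 0 := by rintro rfl; exact ha (by simpa using h)
    funext j
    simp [h, mul_div_mul_left _ _ ht])

/-- The domain `v i ≠ 0` of the affine coordinates. -/
def affineDomain {n : ℕ} (i : Fin (n + 1)) : Set (CP n) :=
  {p | Projectivization.lift (fun v : {v : Fin (n + 1) → ℂ // v ≠ 0} => v.1 i ≠ 0) (by
    rintro ⟨a, ha⟩ ⟨b, hb⟩ t (h : a = t • b)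
    have ht : t ≠ 0 := by rintro rfl; exact ha (by simpa using h)
    simp [h, ht]) p}

theorem insertNth_ne_zero {n : ℕ} (i : Fin (n + 1)) (w : Fin n → ℂ) :
    (i.insertNth 1 w : Fin (n + 1) → ℂ) ≠ 0 := fun h => by
  simpa using congrFun h i

/-- The point with homogeneous coordinates `w`, with `1` inserted in place `i`. -/
def affinePoint {n : ℕ} (i : Fin (n + 1)) (w : Fin n → ℂ) : CP n :=
  Projectivization.mk ℂ (i.insertNth 1 w : Fin (n + 1) → ℂ) (insertNth_ne_zero i w)

theorem affineCoord_affinePoint {n : ℕ} (i : Fin (n + 1)) (w : Fin n → ℂ) :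
    affineCoord i (affinePoint i w) = w := by
  funext j
  simp [affineCoord, affinePoint]

theorem affinePoint_mem {n : ℕ} (i : Fin (n + 1)) (w : Fin n → ℂ) :
    affinePoint i w ∈ affineDomain i := by
  simp [affineDomain, affinePoint]

theorem affinePoint_affineCoord {n : ℕ} (i : Fin (n + 1)) {p : CP n}
    (hp : p ∈ affineDomain i) : affinePoint i (affineCoord i p) = p := by
  induction p using Projectivization.ind with
  | h v hv =>
    have hi : v i ≠ 0 := hp
    refine (Projectivization.mk_eq_mk_iff' ℂ _ _ _ _).2 ⟨(v i)⁻¹, ?_⟩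
    funext j
    refine Fin.succAboveCases i ?_ (fun j => ?_) j
    · simp [hi]
    · simp [affineCoord, div_eq_inv_mul]

theorem isOpen_affineDomain {n : ℕ} (i : Fin (n + 1)) :
    IsOpen (affineDomain i : Set (CP n)) := by
  rw [← (isQuotientMap_mk' n).isOpen_preimage]
  exact isOpen_ne_fun ((continuous_apply i).comp continuous_subtype_val) continuous_const

theorem continuous_affinePoint {n : ℕ} (i : Fin (n + 1)) :
    Continuous (affinePoint i : (Fin n → ℂ) → CP n) := by
  refine (isQuotientMap_mk' n).continuous.comp
    (Continuous.subtype_mk (f := fun w : Fin n → ℂ => (i.insertNth 1 w : Fin (n + 1) → ℂ)) ?_ _)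
  exact Continuous.finInsertNth i continuous_const continuous_id

/-- The standard affine chart `{v i ≠ 0} ≃ ℂⁿ`. -/
def affineChart {n : ℕ} (i : Fin (n + 1)) : OpenPartialHomeomorph (CP n) (Fin n → ℂ) where
  toFun := affineCoord i
  invFun := affinePoint i
  source := affineDomain i
  target := Set.univ
  map_source' _ _ := Set.mem_univ _
  map_target' w _ := affinePoint_mem i w
  left_inv' _ hp := affinePoint_affineCoord i hp
  right_inv' w _ := affineCoord_affinePoint i w
  open_source := isOpen_affineDomain i
  open_target := isOpen_univ
  continuousOn_toFun := by
    rw [(isQuotientMap_mk' n).continuousOn_isOpen_iff (isOpen_affineDomain i)]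
    refine continuousOn_pi.2 fun j => ContinuousOn.div ?_ ?_ ?_
    · exact ((continuous_apply _).comp continuous_subtype_val).continuousOn
    · exact ((continuous_apply _).comp continuous_subtype_val).continuousOn
    · exact fun v hv => hv
  continuousOn_invFun := (continuous_affinePoint i).continuousOn

theorem exists_mem_affineDomain {n : ℕ} (p : CP n) : ∃ i, p ∈ affineDomain i := by
  induction p using Projectivization.ind with
  | h v hv => exact Function.ne_iff.1 hv

/-- The atlas of affine charts. -/
instance instChartedSpaceCP (n : ℕ) : ChartedSpace (Fin n → ℂ) (CP n) where
  atlas := Set.range affineChart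
  chartAt p := affineChart (exists_mem_affineDomain p).choose
  mem_chart_source p := (exists_mem_affineDomain p).choose_spec
  chart_mem_atlas _ := ⟨_, rfl⟩

instance instIsManifoldCP (n : ℕ) : IsManifold 𝓘(ℝ, Fin n → ℂ) ∞ (CP n) := by
  refine isManifold_of_contDiffOn _ _ _ ?_
  rintro _ _ ⟨i, rfl⟩ ⟨i', rfl⟩
  simp only [modelWithCornersSelf_coe, modelWithCornersSelf_coe_symm, Set.range_id,
    Set.inter_univ, Function.id_comp, Function.comp_id, Set.preimage_id]
  have hins : ∀ l : Fin (n + 1),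
      ContDiff ℝ ∞ (fun w : Fin n → ℂ => (i.insertNth 1 w : Fin (n + 1) → ℂ) l) := fun l => by
    refine Fin.succAboveCases i ?_ (fun j => ?_) l
    · simpa using contDiff_const
    · simpa using contDiff_apply ℝ ℂ j
  refine contDiffOn_pi.2 fun j => ?_
  change ContDiffOn ℝ ∞ (fun w : Fin n → ℂ =>
    (i.insertNth 1 w : Fin (n + 1) → ℂ) (i'.succAbove j) /
      (i.insertNth 1 w : Fin (n + 1) → ℂ) i') _
  simp only [div_eq_mul_inv]
  exact (hins _).contDiffOn.mul ((hins _).contDiffOn.inv fun w hw => hw.2)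

/-! ### Theta functions -/

/-- The space of classical theta functions of degree `k` for the lattice `ℤ + τ ℤ`: entire
functions `f` with `f (z + 1) = f z` and `f (z + τ) = exp (-2πikz) f z`. -/
def thetaSpace (k : ℕ) (τ : ℂ) : Submodule ℂ (ℂ → ℂ) where
  carrier := {f | Differentiable ℂ f ∧ (∀ z, f (z + 1) = f z) ∧
    ∀ z, f (z + τ) = Complex.exp (-2 * Real.pi * Complex.I * k * z) * f z}
  zero_mem' := ⟨differentiable_const 0, by simp, by simp⟩
  add_mem' := by
    rintro f g ⟨hf, hf1, hf2⟩ ⟨hg, hg1, hg2⟩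
    exact ⟨hf.add hg, fun z => by simp [hf1, hg1], fun z => by simp [hf2, hg2, mul_add]⟩
  smul_mem' := by
    rintro c f ⟨hf, hf1, hf2⟩
    exact ⟨hf.const_smul c, fun z => by simp [hf1], fun z => by simp [hf2, mul_left_comm]⟩

/-- `θ p z τ = θᵖ(z, τ)`, `p = 0, …, k - 1`, are bases of the spaces of theta functions of
degree `k`, depending smoothly on `τ` in the upper half-plane and invariant under
`τ ↦ τ + 1`. -/
structure IsThetaBasis (k : ℕ) (θ : Fin k → ℂ → ℂ → ℂ) : Prop where
  linearIndependent : ∀ τ : ℂ, 0 < τ.im → LinearIndependent ℂ (fun p z => θ p z τ)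
  span_eq : ∀ τ : ℂ, 0 < τ.im →
    Submodule.span ℂ (Set.range fun p z => θ p z τ) = thetaSpace k τ
  contDiffOn : ∀ p, ContDiffOn ℝ ∞ (fun w : ℂ × ℂ => θ p w.1 w.2) {w | 0 < w.2.im}
  periodic : ∀ p z τ, 0 < τ.im → θ p z (τ + 1) = θ p z τ

/-- The theta series `∑ₘ exp (2πi(p + km)z + πi(2pm + km(m - 1))τ)`; for `k = 1`, `p = 0` this is
the theta function `θ(z, τ) = ∑ₘ exp (2πimz + πim(m - 1)τ)`. -/
def thetaSeries (k : ℕ) (p : Fin k) (z τ : ℂ) : ℂ :=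
  ∑' m : ℤ, Complex.exp (2 * Real.pi * Complex.I * ((p : ℕ) + k * m) * z +
    Real.pi * Complex.I * (2 * (p : ℕ) * m + k * m * (m - 1)) * τ)

/-- The product `θᵖ(z + ix, y + i) · θ^q(y + it, i)`, as a function of `(x, y, z, t)`. -/
def thetaProd {k : ℕ} (θ : Fin k → ℂ → ℂ → ℂ) (p q : Fin k) (u : R4) : ℂ :=
  θ p (u 2 + Complex.I * u 0) (u 1 + Complex.I) * θ q (u 1 + Complex.I * u 3) Complex.I

/-- The space `L_k` of theta functions of degree `k` on `M_KT`. -/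
def thetaSpaceKT {k : ℕ} (θ : Fin k → ℂ → ℂ → ℂ) : Submodule ℂ (R4 → ℂ) :=
  Submodule.span ℂ (Set.range fun pq : Fin k × Fin k => thetaProd θ pq.1 pq.2)

end

end KodairaThurston

/-! Put τ = y + i, w = z + ix, v = y + it. For fixed y and t, w runs over all of ℂ, and the subgroup
generated by `genA` and `genC` acts on it by translations by ℤ + τℤ; v lives on ℂ modulo ℤ + iℤ. So
M_KT is a family of elliptic curves over an elliptic curve, and a product θᵖ(w, τ) θ^q(v, i) is a
theta function on the fibre times one on the base. Every element of Γ multiplies all these products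
at a given point by one common nonzero factor (`IsThetaBasis.exists_factor`), so the projective map
descends.

The embedding then reduces to one complex variable. For k ≥ 3, degree-k theta functions have no
common zero, separate points modulo the lattice and separate tangent directions. This follows from
writing them as products of translates of an infinite product P with simple zeros on the lattice:
the sum of the k zeros is prescribed, and with k ≥ 3 one may fix one zero, move k - 2 others
generically and let the last be determined (`exists_mul_mem_thetaSpace`).

Base and fibre are treated in turn. A base theta function vanishing at v separates y and t; once
these agree, τ is the same at both points and a fibre theta function separates w. Any fibre function
at one τ extends to nearby τ with constant coefficients (`IsThetaBasis.exists_extension`), and the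
extension is only needed at the chosen τ. Compactness of M_KT and the Hausdorff property of ℂPⁿ
upgrade the injective immersion to an embedding.

That the classical series are admissible is a Fourier argument: quasi-periodicity makes k
consecutive Fourier coefficients determine a theta function, and the series realise the standard
basis of coefficient vectors. -/

namespace KodairaThurston

/-! ### Theta functions with prescribed zeros -/

section ThetaZeros

open Complex

/-- `e z = exp (2πiz)`. -/
noncomputable def e (z : ℂ) : ℂ := exp (2 * Real.pi * I * z)

theorem e_add (z w : ℂ) : e (z + w) = e z * e w := by
  simp only [e, ← exp_add]; ring_nf

@[simp] theorem e_zero : e 0 = 1 := by simp [e]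

theorem e_ne_zero (z : ℂ) : e z ≠ 0 := exp_ne_zero _

theorem e_neg_mul (z : ℂ) : e (-z) * e z = 1 := by
  rw [← e_add]; simp

theorem e_int (n : ℤ) : e n = 1 := by
  rw [e, exp_eq_one_iff]; exact ⟨n, by ring⟩

theorem e_one : e 1 = 1 := by simpa using e_int 1

theorem e_nat_mul (n : ℕ) (z : ℂ) : e (n * z) = e z ^ n := by
  rw [e, e, ← exp_nat_mul]; ring_nf

theorem e_half : e (1 / 2) = -1 := by
  rw [e, ← exp_pi_mul_I]; ring_nf

theorem e_eq_one_iff {z : ℂ} : e z = 1 ↔ ∃ n : ℤ, z = n := by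
  rw [e, exp_eq_one_iff]
  have h : (2 * Real.pi * I : ℂ) ≠ 0 := two_pi_I_ne_zero
  refine exists_congr fun n => ⟨fun hn => ?_, fun hn => by rw [hn]; ring⟩
  exact mul_left_cancel₀ h (by rw [hn]; ring)

theorem norm_e (z : ℂ) : ‖e z‖ = Real.exp (-(2 * Real.pi * z.im)) := by
  simp [e, norm_exp]

theorem norm_e_lt_one {τ : ℂ} (hτ : 0 < τ.im) : ‖e τ‖ < 1 := by
  rw [norm_e, Real.exp_lt_one_iff]
  have := Real.pi_pos
  have : 0 < 2 * Real.pi * τ.im := by positivity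
  linarith

theorem hasDerivAt_e (z : ℂ) : HasDerivAt e (2 * Real.pi * I * e z) z := by
  have := ((hasDerivAt_id z).const_mul (2 * Real.pi * I : ℂ)).cexp
  rwa [mul_one, mul_comm (cexp _)] at this

@[fun_prop] theorem differentiable_e : Differentiable ℂ e := fun z =>
  (hasDerivAt_e z).differentiableAt

/-- The infinite product `∏ₙ (1 - qⁿx)`. -/
noncomputable def qProd (q x : ℂ) : ℂ := ∏' n : ℕ, (1 - q ^ n * x)

theorem summable_norm_qProd {q : ℂ} (hq : ‖q‖ < 1) (x : ℂ) :
    Summable fun n : ℕ => ‖-(q ^ n * x)‖ := by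
  simpa using (summable_geometric_of_lt_one (norm_nonneg q) hq).mul_right ‖x‖

theorem multipliable_qProd {q : ℂ} (hq : ‖q‖ < 1) (x : ℂ) :
    Multipliable fun n : ℕ => 1 - q ^ n * x := by
  simpa [sub_eq_add_neg] using multipliable_one_add_of_summable (summable_norm_qProd hq x)

/-- Peeling off the n = 0 factor. Both the zero at the origin and the quasi-periodicity of
`thetaProduct` come from this identity. -/
theorem qProd_eq {q : ℂ} (hq : ‖q‖ < 1) (x : ℂ) : qProd q x = (1 - x) * qProd q (q * x) := by
  have h := multipliable_qProd hq (q * x)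
  rw [qProd, tprod_eq_zero_mul' (f := fun n : ℕ => 1 - q ^ n * x)]
  · simp [qProd, pow_succ, mul_assoc]
  · simpa [pow_succ, mul_assoc] using h

theorem qProd_ne_zero {q : ℂ} (hq : ‖q‖ < 1) {x : ℂ} (hx : ∀ n : ℕ, q ^ n * x ≠ 1) :
    qProd q x ≠ 0 := by
  have := tprod_one_add_ne_zero_of_summable (f := fun n : ℕ => -(q ^ n * x))
    (fun n h => hx n (by linear_combination -h)) (summable_norm_qProd hq x)
  simpa [qProd, sub_eq_add_neg] using this

theorem differentiable_qProd {q : ℂ} (hq : ‖q‖ < 1) : Differentiable ℂ (qProd q) := by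
  intro x
  have hK : IsOpen (Metric.ball (0 : ℂ) (‖x‖ + 1)) := Metric.isOpen_ball
  have hprod := Summable.hasProdLocallyUniformlyOn_nat_one_add (f := fun (n : ℕ) (x : ℂ) => -(q ^ n * x)) hK
    ((summable_geometric_of_lt_one (norm_nonneg q) hq).mul_right (‖x‖ + 1))
    (.of_forall fun n y hy => by
      rw [norm_neg, norm_mul, norm_pow]
      have : ‖y‖ ≤ ‖x‖ + 1 := by simpa using (mem_ball_zero_iff.1 hy).le
      gcongr) (fun n => by fun_prop)
  have hd := hprod.differentiableOn
    (.of_forall fun _ => by simpa [Finset.prod_fn] using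
      DifferentiableOn.finsetProd (fun _ _ => by fun_prop)) hK
  have := (hd x (by simp)).differentiableAt (hK.mem_nhds (by simp))
  simpa [qProd, sub_eq_add_neg, Function.comp_def, funext_iff] using! this

/-- The entire function `∏ₙ (1 - e (nτ + z)) ∏ₙ (1 - e ((n + 1)τ - z))`, with simple zeros exactly
at the points of `ℤ + τℤ`. -/
noncomputable def thetaProduct (τ z : ℂ) : ℂ :=
  qProd (e τ) (e z) * qProd (e τ) (e τ * e (-z))

theorem thetaProduct_eq {τ : ℂ} (hτ : 0 < τ.im) (z : ℂ) :
    thetaProduct τ z = (1 - e z) * (qProd (e τ) (e τ * e z) * qProd (e τ) (e τ * e (-z))) := by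
  rw [thetaProduct, qProd_eq (norm_e_lt_one hτ) (e z), mul_assoc]

theorem differentiable_thetaProduct {τ : ℂ} (hτ : 0 < τ.im) :
    Differentiable ℂ (thetaProduct τ) := by
  have := differentiable_qProd (norm_e_lt_one hτ)
  unfold thetaProduct
  fun_prop

theorem thetaProduct_add_one (τ z : ℂ) : thetaProduct τ (z + 1) = thetaProduct τ z := by
  have h : e (-1) = 1 := by simpa using e_int (-1)
  rw [thetaProduct, thetaProduct, neg_add, e_add, e_add, e_one, h, mul_one, mul_one]

/-- The shift by τ removes the factor 1 - e(z) from the first product and adds 1 - e(-z) to the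
second; their ratio is -e(-z) = e(1/2 - z). -/
theorem thetaProduct_add_tau {τ : ℂ} (hτ : 0 < τ.im) (z : ℂ) :
    thetaProduct τ (z + τ) = e (1 / 2 - z) * thetaProduct τ z := by
  have h1 : e τ * e (-(z + τ)) = e (-z) := by rw [← e_add]; ring_nf
  rw [thetaProduct_eq hτ z, thetaProduct, h1, qProd_eq (norm_e_lt_one hτ) (e (-z)),
    sub_eq_add_neg (1 / 2) z, e_add, e_add, e_half, mul_comm (e z)]
  linear_combination
    -(qProd (e τ) (e τ * e z) * qProd (e τ) (e τ * e (-z))) * e_neg_mul z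

theorem exists_of_thetaProduct_eq_zero {τ : ℂ} (hτ : 0 < τ.im) {z : ℂ}
    (h : thetaProduct τ z = 0) : ∃ m n : ℤ, z = m + n * τ := by
  by_contra! hz
  refine mul_ne_zero (qProd_ne_zero (norm_e_lt_one hτ) fun n hn => ?_)
    (qProd_ne_zero (norm_e_lt_one hτ) fun n hn => ?_) h
  · rw [← e_nat_mul, ← e_add, e_eq_one_iff] at hn
    obtain ⟨m, hm⟩ := hn
    exact hz m (-n) (by push_cast; linear_combination hm)
  · rw [← e_nat_mul, ← e_add, ← e_add, e_eq_one_iff] at hn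
    obtain ⟨m, hm⟩ := hn
    exact hz (-m) (n + 1) (by push_cast; linear_combination -hm)

theorem thetaProduct_zero {τ : ℂ} (hτ : 0 < τ.im) : thetaProduct τ 0 = 0 := by
  simp [thetaProduct_eq hτ]

/-- The factor 1 - e(z) has a simple zero at 0, and its cofactor there is a square of a product of
terms 1 - qⁿ⁺¹ with |q| < 1, hence nonzero. -/
theorem deriv_thetaProduct_zero_ne_zero {τ : ℂ} (hτ : 0 < τ.im) :
    deriv (thetaProduct τ) 0 ≠ 0 := by
  have hq := norm_e_lt_one hτ
  have h0 : qProd (e τ) (e τ) ≠ 0 := qProd_ne_zero hq fun n hn => by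
    have h := congrArg norm hn
    rw [← pow_succ, norm_pow, norm_one] at h
    exact (pow_lt_one₀ (norm_nonneg _) hq n.succ_ne_zero).ne h
  have hd : Differentiable ℂ
      fun z => qProd (e τ) (e τ * e z) * qProd (e τ) (e τ * e (-z)) := by
    have := differentiable_qProd hq
    fun_prop
  have h1 := ((hasDerivAt_e 0).const_sub 1).mul (hd 0).hasDerivAt
  have h2 : thetaProduct τ = (fun z => 1 - e z) *
      fun z => qProd (e τ) (e τ * e z) * qProd (e τ) (e τ * e (-z)) :=
    funext fun z => thetaProduct_eq hτ z
  rw [h2, h1.deriv]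
  simp [h0, Real.pi_ne_zero]

/-- Abel's condition with k = j + 3: the τ-multipliers combine to e(k/2 - kz + sum of zeros), and a
zero sum of k/2 turns the constant into e(k) = 1. -/
theorem thetaProduct_mul_mem_thetaSpace {τ : ℂ} (hτ : 0 < τ.im) {j : ℕ} {a b c : ℂ}
    (h : a + (j + 1) * b + c = (j + 3) / 2) :
    (fun z => thetaProduct τ (z - a) * (thetaProduct τ (z - b) ^ (j + 1) * thetaProduct τ (z - c)))
      ∈ thetaSpace (j + 3) τ := by
  have hd := differentiable_thetaProduct hτ
  refine ⟨by fun_prop, fun z => ?_, fun z => ?_⟩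
  · simp only [add_sub_right_comm z 1, thetaProduct_add_one]
  · simp only [add_sub_right_comm z τ, thetaProduct_add_tau hτ, mul_pow, ← e_nat_mul]
    have key : cexp (-2 * Real.pi * I * ((j + 3 : ℕ) : ℂ) * z) =
        e (1 / 2 - (z - a)) * (e ((j + 1 : ℕ) * (1 / 2 - (z - b))) * e (1 / 2 - (z - c))) := by
      rw [← e_add, ← e_add]
      have h1 : (1 / 2 - (z - a) + ((j + 1 : ℕ) * (1 / 2 - (z - b)) + (1 / 2 - (z - c))) : ℂ) =
          -(j + 3) * z + ((j + 3 : ℤ) : ℂ) := by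
        push_cast; linear_combination h
      rw [h1, e_add, e_int, e]
      push_cast; ring_nf
    rw [key]
    ring

/-- Each condition excludes countably many `b`, and ℂ is uncountable. -/
theorem exists_shift_notMem (τ z w : ℂ) (j : ℕ) : ∃ b : ℂ,
    (∀ m n : ℤ, z - b ≠ m + n * τ) ∧ ∀ m n : ℤ, w + (j + 1) * b ≠ m + n * τ := by
  set S : Set ℂ := Set.range (fun p : ℤ × ℤ => z - (p.1 + p.2 * τ)) ∪
    Set.range (fun p : ℤ × ℤ => (p.1 + p.2 * τ - w) / (j + 1))
  have hS : S.Countable := (Set.countable_range _).union (Set.countable_range _)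
  obtain ⟨b, hb⟩ : ∃ b, b ∉ S := by
    by_contra! h
    exact not_countable_complex (hS.mono fun x _ => h x)
  have hj : (j + 1 : ℂ) ≠ 0 := by exact_mod_cast j.succ_ne_zero
  refine ⟨b, fun m n h => hb (Or.inl ⟨(m, n), ?_⟩), fun m n h => hb (Or.inr ⟨(m, n), ?_⟩)⟩
  · simp only [← h]; ring
  · simp only [← h]; field_simp; ring

/-- There is a theta function of the form `P (z - z₀) g z` with `g z₁ ≠ 0`. -/
theorem exists_mul_mem_thetaSpace {k : ℕ} (hk : 3 ≤ k) {τ : ℂ} (hτ : 0 < τ.im) (z₀ z₁ : ℂ) :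
    ∃ g : ℂ → ℂ, Differentiable ℂ g ∧ g z₁ ≠ 0 ∧
      (fun z => thetaProduct τ (z - z₀) * g z) ∈ thetaSpace k τ := by
  obtain ⟨j, rfl⟩ := Nat.exists_eq_add_of_le' hk
  -- The zeros are z₀, b with multiplicity k - 2 ≥ 1, and c = k/2 - z₀ - (k - 2)b. The second
  -- argument is chosen so that w + (j + 1)b = z₁ - c.
  obtain ⟨b, hb, hc⟩ := exists_shift_notMem τ z₁ (z₁ + z₀ - (j + 3) / 2) j
  have hd := differentiable_thetaProduct hτ
  refine ⟨_, ?_, ?_, thetaProduct_mul_mem_thetaSpace hτ (a := z₀) (b := b)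
    (c := (j + 3) / 2 - z₀ - (j + 1) * b) (by ring)⟩
  · fun_prop
  · refine mul_ne_zero (pow_ne_zero _ fun h => ?_) fun h => ?_
    · obtain ⟨m, n, h⟩ := exists_of_thetaProduct_eq_zero hτ h
      exact hb m n h
    · obtain ⟨m, n, h⟩ := exists_of_thetaProduct_eq_zero hτ h
      exact hc m n (by rw [← h]; ring)

theorem exists_thetaSpace_separating {k : ℕ} (hk : 3 ≤ k) {τ : ℂ} (hτ : 0 < τ.im) {z₀ z₁ : ℂ}
    (h : ¬ ∃ m n : ℤ, z₁ - z₀ = m + n * τ) : ∃ f ∈ thetaSpace k τ, f z₀ = 0 ∧ f z₁ ≠ 0 := by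
  obtain ⟨g, -, hg, hmem⟩ := exists_mul_mem_thetaSpace hk hτ z₀ z₁
  exact ⟨_, hmem, by simp [thetaProduct_zero hτ],
    mul_ne_zero (fun h0 => h (exists_of_thetaProduct_eq_zero hτ h0)) hg⟩

theorem exists_thetaSpace_deriv_ne_zero {k : ℕ} (hk : 3 ≤ k) {τ : ℂ} (hτ : 0 < τ.im) (z₀ : ℂ) :
    ∃ f ∈ thetaSpace k τ, f z₀ = 0 ∧ deriv f z₀ ≠ 0 := by
  -- Taking z₁ = z₀ makes the cofactor nonzero at z₀, so the zero there stays simple.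
  obtain ⟨g, hgd, hg, hmem⟩ := exists_mul_mem_thetaSpace hk hτ z₀ z₀
  refine ⟨_, hmem, by simp [thetaProduct_zero hτ], ?_⟩
  have hd := differentiable_thetaProduct hτ
  have h1 : DifferentiableAt ℂ (fun z => thetaProduct τ (z - z₀)) z₀ := by fun_prop
  have h2 := (h1.hasDerivAt.mul (hgd z₀).hasDerivAt).deriv
  have h3 : deriv (fun z => thetaProduct τ (z - z₀)) z₀ = deriv (thetaProduct τ) 0 := by
    rw [deriv_comp_sub_const, sub_self]
  rw [h3, sub_self, thetaProduct_zero hτ, zero_mul, add_zero] at h2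
  exact h2 ▸ mul_ne_zero (deriv_thetaProduct_zero_ne_zero hτ) hg

theorem exists_thetaSpace_ne_zero {k : ℕ} (hk : 3 ≤ k) {τ : ℂ} (hτ : 0 < τ.im) (z : ℂ) :
    ∃ f ∈ thetaSpace k τ, f z ≠ 0 := by
  obtain ⟨b, hb, -⟩ := exists_shift_notMem τ z 0 0
  obtain ⟨f, hf, -, h⟩ := exists_thetaSpace_separating hk hτ (z₀ := b) (z₁ := z)
    (by push Not; exact hb)
  exact ⟨f, hf, h⟩

end ThetaZeros

/-! ### Fourier coefficients of theta functions -/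

section Fourier

open Complex

/-- A real shift is absorbed by periodicity. An imaginary shift is Cauchy's theorem on a rectangle
of width 1, whose vertical sides cancel. -/
theorem intervalIntegral_eq_of_periodic {g : ℂ → ℂ} (hg : Differentiable ℂ g)
    (hp : ∀ z, g (z + 1) = g z) (w : ℂ) :
    ∫ x in (0 : ℝ)..1, g (x + w) = ∫ x in (0 : ℝ)..1, g x := by
  have h1 : ∫ x in (0 : ℝ)..1, g (x + w) = ∫ x in (0 : ℝ)..1, g (x + w.im * I) := by
    have hper : Function.Periodic (fun x : ℝ => g (x + w.im * I)) 1 := fun x => by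
      simp only [← hp (x + w.im * I)]; push_cast; ring_nf
    have h := hper.intervalIntegral_add_eq w.re 0
    rw [zero_add] at h
    rw [← h, add_comm w.re 1]
    have h2 := intervalIntegral.integral_comp_add_right (a := 0) (b := 1)
      (fun x : ℝ => g (x + w.im * I)) w.re
    rw [zero_add] at h2
    rw [← h2]
    congr 1 with x
    conv_lhs => rw [← re_add_im w]
    push_cast; ring_nf
  have h2 := integral_boundary_rect_eq_zero_of_differentiableOn g 0 (1 + w.im * I)
    hg.differentiableOn
  have h3 : ∀ y : ℝ, g (1 + y * I) = g (y * I) := fun y => by rw [add_comm, hp]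
  simp [h3] at h2
  rw [h1]
  exact (sub_eq_zero.1 h2).symm

/-- The Fourier coefficient `∫₀¹ e (-nx) f x dx`. -/
noncomputable def lineCoeff (n : ℤ) (f : ℂ → ℂ) : ℂ := ∫ x in (0 : ℝ)..1, e (-(n * x)) * f x

theorem lineCoeff_eq_integral_add {f : ℂ → ℂ} (hf : Differentiable ℂ f)
    (hp : ∀ z, f (z + 1) = f z) (n : ℤ) (w : ℂ) :
    lineCoeff n f = ∫ x in (0 : ℝ)..1, e (-(n * (x + w))) * f (x + w) := by
  have h := intervalIntegral_eq_of_periodic (g := fun z => e (-(n * z)) * f z) (by fun_prop)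
    (fun z => by
      have h1 : (-(n * (z + 1)) : ℂ) = -(n * z) + ((-n : ℤ) : ℂ) := by push_cast; ring
      simp only [hp, h1, e_add, e_int, mul_one]) w
  exact h.symm

/-- Moving the contour up by τ and applying quasi-periodicity links frequency n to frequency n + k.
-/
theorem lineCoeff_of_mem_thetaSpace {k : ℕ} {τ : ℂ} {f : ℂ → ℂ} (hf : f ∈ thetaSpace k τ)
    (n : ℤ) : lineCoeff n f = e (-(n * τ)) * lineCoeff (n + k) f := by
  obtain ⟨hd, h1, h2⟩ := hf
  rw [lineCoeff_eq_integral_add hd h1 n τ, lineCoeff, ← intervalIntegral.integral_const_mul]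
  congr 1 with x
  have h3 : cexp (-2 * Real.pi * I * k * x) = e (-(k * x)) := by rw [e]; ring_nf
  have h4 : (-(((n + k : ℤ) : ℂ) * x)) = -(n * x) + -(k * x) := by push_cast; ring
  have h5 : (-(n * (x + τ)) : ℂ) = -(n * τ) + -(n * x) := by ring
  rw [h2, h3, h4, h5, e_add, e_add]
  ring

/-- On the horizontal line through `w`, the Fourier coefficients are e(nw) times those on the real
line, so they all vanish and the (trivially summable) Fourier series gives f(w) = 0. -/
theorem eq_zero_of_lineCoeff_eq_zero {f : ℂ → ℂ} (hf : Differentiable ℂ f)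
    (hp : ∀ z, f (z + 1) = f z) (h : ∀ n, lineCoeff n f = 0) : f = 0 := by
  funext w
  have hper : Function.Periodic (fun x : ℝ => f (x + w)) 1 := fun x => by
    simp only [← hp (x + w)]; push_cast; ring_nf
  have hcont : Continuous (fun x : ℝ => f (x + w)) := by
    have := hf.continuous; fun_prop
  have : Fact ((0 : ℝ) < 1) := ⟨one_pos⟩
  set F : C(AddCircle (1 : ℝ), ℂ) := ⟨hper.lift, continuous_coinduced_dom.2 hcont⟩ with hF
  have hFx : ∀ x : ℝ, F x = f (x + w) := fun x => rfl
  have hcoeff : fourierCoeff F = 0 := by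
    funext n
    rw [fourierCoeff_eq_intervalIntegral _ n 0]
    have h1 := lineCoeff_eq_integral_add hf hp n w
    rw [h n] at h1
    have h2 : ∀ x : ℝ, fourier (-n) (x : AddCircle (1 : ℝ)) • F x =
        e (n * w) * (e (-(n * (x + w))) * f (x + w)) := fun x => by
      rw [← mul_assoc, ← e_add, fourier_coe_apply, hFx, smul_eq_mul, e]
      congr 2
      push_cast; ring
    simp only [h2, zero_add, intervalIntegral.integral_const_mul, ← h1]
    simp
  have hs := has_pointwise_sum_fourier_series_of_summable (f := F)
    (by rw [hcoeff]; exact summable_zero) ((0 : ℝ) : AddCircle (1 : ℝ))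
  rw [hcoeff] at hs
  simp only [Pi.zero_apply, zero_smul] at hs
  have := hs.unique hasSum_zero
  rw [hFx] at this
  simpa using this

/-- By the recursion, vanishing of a coefficient depends only on its index modulo k. -/
theorem eq_zero_of_mem_thetaSpace {k : ℕ} (hk : k ≠ 0) {τ : ℂ} {f : ℂ → ℂ}
    (hf : f ∈ thetaSpace k τ) (h : ∀ p : Fin k, lineCoeff (p : ℕ) f = 0) : f = 0 := by
  refine eq_zero_of_lineCoeff_eq_zero hf.1 hf.2.1 fun n => ?_
  have hper : Function.Periodic (fun n : ℤ => lineCoeff n f = 0) (k : ℤ) := fun n => by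
    simp [lineCoeff_of_mem_thetaSpace hf n, e_ne_zero]
  have hk' : (0 : ℤ) < k := by omega
  have h0 := Int.emod_nonneg n hk'.ne'
  have h1 := Int.emod_lt_of_pos n hk'
  have h2 := h ⟨(n % k).toNat, by omega⟩
  have h3 := hper.sub_int_mul_eq (x := n) (n / k)
  have h4 : n - n / k * (k : ℤ) = n % k := by
    have := Int.emod_add_mul_ediv n k; linarith
  simp only [Int.cast_id, h4] at h3
  rw [← h3]
  simpa [Int.toNat_of_nonneg h0] using h2

theorem intervalIntegrable_lineCoeff {f : ℂ → ℂ} (hf : Differentiable ℂ f) (n : ℤ) :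
    IntervalIntegrable (fun x : ℝ => e (-(n * x)) * f x) MeasureTheory.volume 0 1 := by
  have h1 := hf.continuous
  have h2 := differentiable_e.continuous
  exact Continuous.intervalIntegrable (by fun_prop) _ _

/-- The first `k` Fourier coefficients of a theta function of degree `k`. -/
noncomputable def thetaCoeff (k : ℕ) (τ : ℂ) : thetaSpace k τ →ₗ[ℂ] (Fin k → ℂ) where
  toFun f p := lineCoeff (p : ℕ) f
  map_add' f g := by
    funext p
    simp only [lineCoeff, Submodule.coe_add, Pi.add_apply, mul_add]
    exact intervalIntegral.integral_add (intervalIntegrable_lineCoeff f.2.1 _)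
      (intervalIntegrable_lineCoeff g.2.1 _)
  map_smul' c f := by
    funext p
    simp only [lineCoeff, Submodule.coe_smul, Pi.smul_apply, smul_eq_mul, mul_left_comm _ c,
      intervalIntegral.integral_const_mul, RingHom.id_apply]

theorem injective_thetaCoeff {k : ℕ} (hk : k ≠ 0) (τ : ℂ) :
    Function.Injective (thetaCoeff k τ) := by
  refine (injective_iff_map_eq_zero _).2 fun f hf => ?_
  exact Subtype.ext (eq_zero_of_mem_thetaSpace hk f.2 fun p => congrFun hf p)

end Fourier

/-! ### The theta series -/

section ThetaSeries

open Complex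

theorem thetaSeries_term_eq (k : ℕ) (p : ℕ) (z τ : ℂ) (m : ℤ) :
    cexp (2 * Real.pi * I * (p + k * m) * z +
      Real.pi * I * (2 * p * m + k * m * (m - 1)) * τ) =
    e (p * z) * jacobiTheta₂_term m (k * z + p * τ - k * τ / 2) (k * τ) := by
  rw [jacobiTheta₂_term, e, ← exp_add]
  ring_nf

theorem thetaSeries_eq {k : ℕ} (p : Fin k) (z τ : ℂ) :
    thetaSeries k p z τ = e ((p : ℕ) * z) *
      jacobiTheta₂ (k * z + (p : ℕ) * τ - k * τ / 2) (k * τ) := by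
  simp only [thetaSeries, thetaSeries_term_eq, tsum_mul_left, jacobiTheta₂]

theorem natCast_mul_im_pos {k : ℕ} (p : Fin k) {τ : ℂ} (hτ : 0 < τ.im) : 0 < ((k : ℂ) * τ).im := by
  have : (0 : ℝ) < k := by exact_mod_cast p.pos
  simpa using mul_pos this hτ

theorem thetaSeries_mem_thetaSpace {k : ℕ} (p : Fin k) {τ : ℂ} (hτ : 0 < τ.im) :
    (fun z => thetaSeries k p z τ) ∈ thetaSpace k τ := by
  have hkτ := natCast_mul_im_pos p hτ
  refine ⟨?_, fun z => ?_, fun z => ?_⟩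
  · have h1 : Differentiable ℂ fun z => jacobiTheta₂ z (k * τ) := fun z =>
      differentiableAt_jacobiTheta₂_fst z hkτ
    have h2 : Differentiable ℂ fun z : ℂ => (k * z + (p : ℕ) * τ - k * τ / 2 : ℂ) := by fun_prop
    simp only [thetaSeries_eq]
    exact Differentiable.mul (by fun_prop) (h1.comp h2)
  · refine tsum_congr fun m => ?_
    have h : (2 * Real.pi * I * ((p : ℕ) + k * m) * (z + 1) +
        Real.pi * I * (2 * (p : ℕ) * m + k * m * (m - 1)) * τ : ℂ) =
        (2 * Real.pi * I * ((p : ℕ) + k * m) * z +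
        Real.pi * I * (2 * (p : ℕ) * m + k * m * (m - 1)) * τ) +
        ((p : ℕ) + k * m : ℤ) * (2 * Real.pi * I) := by push_cast; ring
    rw [h, exp_add, exp_int_mul_two_pi_mul_I, mul_one]
  · have h1 : (k * (z + τ) + (p : ℕ) * τ - k * τ / 2 : ℂ) =
        k * z + (p : ℕ) * τ - k * τ / 2 + k * τ := by ring
    simp only [thetaSeries_eq]
    rw [h1, jacobiTheta₂_add_left', e, e, ← mul_assoc, ← exp_add,
      ← mul_assoc (cexp _) (cexp _), ← exp_add]
    ring_nf

theorem thetaSeries_add_one {k : ℕ} (p : Fin k) (z τ : ℂ) :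
    thetaSeries k p z (τ + 1) = thetaSeries k p z τ := by
  refine tsum_congr fun m => ?_
  -- Since m(m - 1) is even, the extra exponent πik·m(m - 1) is an integral multiple of 2πi.
  obtain ⟨r, hr⟩ := Int.even_mul_pred_self m
  have hr' : (m * (m - 1) : ℂ) = r + r := by exact_mod_cast hr
  have h : (2 * Real.pi * I * ((p : ℕ) + k * m) * z +
      Real.pi * I * (2 * (p : ℕ) * m + k * m * (m - 1)) * (τ + 1) : ℂ) =
      (2 * Real.pi * I * ((p : ℕ) + k * m) * z +
      Real.pi * I * (2 * (p : ℕ) * m + k * m * (m - 1)) * τ) +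
      ((p : ℕ) * m + k * r : ℤ) * (2 * Real.pi * I) := by
    push_cast; linear_combination (Real.pi * I * k) * hr'
  rw [h, exp_add, exp_int_mul_two_pi_mul_I, mul_one]

theorem integral_e_int_mul (n : ℤ) :
    ∫ x in (0 : ℝ)..1, e (n * x) = if n = 0 then 1 else 0 := by
  split_ifs with hn
  · simp [hn]
  · have hc : (2 * Real.pi * I * n : ℂ) ≠ 0 := mul_ne_zero two_pi_I_ne_zero (by exact_mod_cast hn)
    have h := integral_exp_mul_complex (a := 0) (b := 1) hc
    have h1 := e_int n
    rw [e] at h1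
    simp only [e, ← mul_assoc]
    rw [h]
    simp [h1]

/-- The series has frequencies p + km, and for 0 ≤ p, q < k only m = 0 can give frequency q; that
term has coefficient 1. Integration is termwise because |e| = 1 on multiples of real x, so the sup
norms are those of a convergent Jacobi series. -/
theorem lineCoeff_thetaSeries {k : ℕ} (p q : Fin k) {τ : ℂ} (hτ : 0 < τ.im) :
    lineCoeff (q : ℕ) (fun z => thetaSeries k p z τ) = if q = p then 1 else 0 := by
  set a : ℤ → ℂ := fun m => jacobiTheta₂_term m ((p : ℕ) * τ - k * τ / 2) (k * τ) with ha
  have hterm : ∀ (m : ℤ) (x : ℝ), e (-(((q : ℕ) : ℤ) * x)) *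
      cexp (2 * Real.pi * I * ((p : ℕ) + k * m) * x +
        Real.pi * I * (2 * (p : ℕ) * m + k * m * (m - 1)) * τ) =
      a m * e (((p : ℕ) + k * m - (q : ℕ) : ℤ) * x) := fun m x => by
    rw [ha]
    simp only [jacobiTheta₂_term, e, ← exp_add]
    push_cast; ring_nf
  set F : ℤ → C(ℝ, ℂ) := fun m => ⟨fun x => a m * e (((p : ℕ) + k * m - (q : ℕ) : ℤ) * x), by
    have := differentiable_e.continuous; fun_prop⟩ with hF
  have hsum : Summable fun m =>
      ‖(F m).restrict (⟨Set.uIcc 0 1, isCompact_uIcc⟩ : TopologicalSpace.Compacts ℝ)‖ := by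
    refine Summable.of_nonneg_of_le (fun _ => norm_nonneg _) (fun m => ?_)
      ((summable_jacobiTheta₂_term_iff ((p : ℕ) * τ - k * τ / 2) _).2
        (natCast_mul_im_pos p hτ)).norm
    refine (ContinuousMap.norm_le _ (norm_nonneg _)).2 fun x => ?_
    simp [hF, norm_e, ha]
  have hint := intervalIntegral.tsum_intervalIntegral_eq_of_summable_norm hsum
  have h1 : lineCoeff (q : ℕ) (fun z => thetaSeries k p z τ) =
      ∫ x in (0 : ℝ)..1, ∑' m, F m x := by
    simp only [lineCoeff, thetaSeries, ← tsum_mul_left]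
    congr 1 with x
    exact tsum_congr fun m => hterm m x
  have h2 : ∀ m, ∫ x in (0 : ℝ)..1, F m x =
      if ((p : ℕ) + k * m - (q : ℕ) : ℤ) = 0 then a m else 0 := fun m => by
    simp only [hF, ContinuousMap.coe_mk, intervalIntegral.integral_const_mul, integral_e_int_mul]
    simp
  have h3 : ∀ m : ℤ, ((p : ℕ) + k * m - (q : ℕ) : ℤ) = 0 ↔ m = 0 ∧ q = p := fun m => by
    constructor
    · intro h
      have hp := p.isLt
      have hq := q.isLt
      have hm : m = 0 := by
        by_contra hm
        rcases lt_or_gt_of_ne hm with hm | hm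
        · nlinarith
        · nlinarith
      subst hm
      exact ⟨rfl, Fin.ext (by omega)⟩
    · rintro ⟨rfl, rfl⟩; ring
  rw [h1, ← hint]
  simp only [h2, h3]
  rw [tsum_eq_single 0 fun m hm => by simp [hm]]
  have ha0 : a 0 = 1 := by simp [ha, jacobiTheta₂_term]
  simp [ha0]

theorem linearIndependent_thetaSeries (k : ℕ) {τ : ℂ} (hτ : 0 < τ.im) :
    LinearIndependent ℂ (fun p z => thetaSeries k p z τ) := by
  set v : Fin k → thetaSpace k τ := fun p => ⟨_, thetaSeries_mem_thetaSpace p hτ⟩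
  have hv : LinearIndependent ℂ (thetaCoeff k τ ∘ v) := by
    have : thetaCoeff k τ ∘ v = fun p => Pi.single p (1 : ℂ) := by
      funext p q
      exact (lineCoeff_thetaSeries p q hτ).trans (by simp [Pi.single_apply])
    rw [this]
    exact Pi.linearIndependent_single_one _ _
  exact (hv.of_comp).map' (thetaSpace k τ).subtype (Submodule.ker_subtype _)

/-- The k independent series already fill a space that injects into ℂᵏ. -/
theorem span_thetaSeries {k : ℕ} (hk : k ≠ 0) {τ : ℂ} (hτ : 0 < τ.im) :
    Submodule.span ℂ (Set.range fun p z => thetaSeries k p z τ) = thetaSpace k τ := by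
  have : FiniteDimensional ℂ (thetaSpace k τ) :=
    FiniteDimensional.of_injective _ (injective_thetaCoeff hk τ)
  refine Submodule.eq_of_le_of_finrank_le ?_ ?_
  · rw [Submodule.span_le]
    rintro _ ⟨p, rfl⟩
    exact thetaSeries_mem_thetaSpace p hτ
  · rw [finrank_span_eq_card (linearIndependent_thetaSeries k hτ)]
    simpa using LinearMap.finrank_le_finrank_of_injective (injective_thetaCoeff hk τ)

end ThetaSeries

/-! ### Smoothness of the theta series -/

section Smoothness

open Complex

/-- The Jacobi theta series with coefficients `nʲ`. -/
noncomputable def jacobiThetaMoment (j : ℕ) (w : ℂ × ℂ) : ℂ :=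
  ∑' n : ℤ, (n : ℂ) ^ j * jacobiTheta₂_term n w.1 w.2

theorem summable_jacobiThetaMoment (j : ℕ) (z : ℂ) {τ : ℂ} (hτ : 0 < τ.im) :
    Summable fun n : ℤ => (n : ℂ) ^ j * jacobiTheta₂_term n z τ := by
  refine (summable_pow_mul_jacobiTheta₂_term_bound |z.im| hτ j).of_norm_bounded fun n => ?_
  rw [norm_mul, norm_pow, norm_intCast, Int.cast_abs]
  gcongr
  simpa using norm_jacobiTheta₂_term_le hτ le_rfl le_rfl n

/-- Differentiating a term in z brings down 2πin, in τ brings down πin². The moments are thus closed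
under differentiation, which drives the induction on the order of smoothness. -/
theorem hasFDerivAt_jacobiThetaMoment (j : ℕ) {w : ℂ × ℂ} (hw : 0 < w.2.im) :
    HasFDerivAt (jacobiThetaMoment j)
      ((2 * Real.pi * I * jacobiThetaMoment (j + 1) w) • ContinuousLinearMap.fst ℂ ℂ ℂ +
        (Real.pi * I * jacobiThetaMoment (j + 2) w) • ContinuousLinearMap.snd ℂ ℂ ℂ) w := by
  obtain ⟨T, hT, hτ'⟩ := exists_between hw
  obtain ⟨S, hz⟩ := exists_gt |w.1.im|
  -- On this convex neighbourhood the terms have a summable bound independent of the point, as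
  -- termwise differentiation requires.
  set V : Set (ℂ × ℂ) := {u | |im u| < S} ×ˢ {v | T < im v}
  have hVo : IsOpen V := by
    refine ((_root_.continuous_abs.comp continuous_im).isOpen_preimage _ isOpen_Iio).prod ?_
    exact continuous_im.isOpen_preimage _ isOpen_Ioi
  have hVmem : w ∈ V := ⟨hz, hτ'⟩
  have hVp : IsPreconnected V := by
    refine (Convex.isPreconnected ?_).prod (convex_halfSpace_im_gt T).isPreconnected
    simpa only [abs_lt] using! (convex_halfSpace_im_gt _).inter (convex_halfSpace_im_lt _)
  set f' : ℤ → ℂ × ℂ → ℂ × ℂ →L[ℂ] ℂ := fun n p =>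
    (2 * Real.pi * I * ((n : ℂ) ^ (j + 1) * jacobiTheta₂_term n p.1 p.2)) •
      ContinuousLinearMap.fst ℂ ℂ ℂ +
    (Real.pi * I * ((n : ℂ) ^ (j + 2) * jacobiTheta₂_term n p.1 p.2)) •
      ContinuousLinearMap.snd ℂ ℂ ℂ with hf'
  have hf : ∀ (n : ℤ), ∀ p ∈ V,
      HasFDerivAt (fun p : ℂ × ℂ => (n : ℂ) ^ j * jacobiTheta₂_term n p.1 p.2) (f' n p) p := by
    intro n p _
    refine ((hasFDerivAt_jacobiTheta₂_term n p.1 p.2).const_mul ((n : ℂ) ^ j)).congr_fderiv ?_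
    ext <;> simp [hf', jacobiTheta₂_term_fderiv, jacobiTheta₂_term] <;> ring
  set B : ℤ → ℝ := fun n => Real.exp (-Real.pi * (T * n ^ 2 - 2 * S * |n|))
  have hterm : ∀ (n : ℤ) (i : ℕ), ∀ p ∈ V,
      ‖(n : ℂ) ^ i * jacobiTheta₂_term n p.1 p.2‖ ≤ |(n : ℝ)| ^ i * B n := by
    intro n i p hp
    rw [norm_mul, norm_pow, norm_intCast]
    gcongr
    simpa [B] using norm_jacobiTheta₂_term_le hT (le_of_lt hp.1) (le_of_lt hp.2) n
  have hB : ∀ i : ℕ, Summable fun n : ℤ => |(n : ℝ)| ^ i * B n := fun i => by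
    simpa [B] using summable_pow_mul_jacobiTheta₂_term_bound S hT i
  have hpi : ‖(Real.pi : ℂ)‖ = Real.pi := by simp [Real.pi_pos.le]
  have hu : ∀ (n : ℤ), ∀ p ∈ V, ‖f' n p‖ ≤
      2 * Real.pi * (|(n : ℝ)| ^ (j + 1) * B n) + Real.pi * (|(n : ℝ)| ^ (j + 2) * B n) := by
    intro n p hp
    refine (norm_add_le _ _).trans (add_le_add ?_ ?_)
    · rw [norm_smul, norm_mul, norm_mul, norm_mul, norm_I, hpi, Complex.norm_two, mul_one]
      refine (mul_le_of_le_one_right (by positivity) (ContinuousLinearMap.norm_fst_le _ _ _)).trans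
        ?_
      gcongr
      exact hterm n (j + 1) p hp
    · rw [norm_smul, norm_mul, norm_mul, norm_I, hpi, mul_one]
      refine (mul_le_of_le_one_right (by positivity) (ContinuousLinearMap.norm_snd_le _ _ _)).trans
        ?_
      gcongr
      exact hterm n (j + 2) p hp
  have hmain := hasFDerivAt_tsum_of_isPreconnected
    (((hB (j + 1)).mul_left (2 * Real.pi)).add ((hB (j + 2)).mul_left Real.pi)) hVo hVp hf hu hVmem
    (summable_jacobiThetaMoment j w.1 hw) hVmem
  have hs : HasSum (fun n => f' n w)
      ((2 * Real.pi * I * jacobiThetaMoment (j + 1) w) • ContinuousLinearMap.fst ℂ ℂ ℂ +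
        (Real.pi * I * jacobiThetaMoment (j + 2) w) • ContinuousLinearMap.snd ℂ ℂ ℂ) :=
    (((summable_jacobiThetaMoment (j + 1) w.1 hw).hasSum.mul_left _).smul_const _).add
      (((summable_jacobiThetaMoment (j + 2) w.1 hw).hasSum.mul_left _).smul_const _)
  rw [hs.tsum_eq] at hmain
  exact hmain

theorem isOpen_snd_im_pos : IsOpen {w : ℂ × ℂ | 0 < w.2.im} :=
  isOpen_lt continuous_const (continuous_im.comp continuous_snd)

theorem contDiffOn_jacobiThetaMoment (N j : ℕ) :
    ContDiffOn ℂ N (jacobiThetaMoment j) {w : ℂ × ℂ | 0 < w.2.im} := by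
  induction N generalizing j with
  | zero =>
    exact contDiffOn_zero.2 fun w hw =>
      (hasFDerivAt_jacobiThetaMoment j hw).continuousAt.continuousWithinAt
  | succ N ih =>
    push_cast
    rw [contDiffOn_succ_iff_fderiv_of_isOpen isOpen_snd_im_pos]
    refine ⟨fun w hw => (hasFDerivAt_jacobiThetaMoment j hw).differentiableAt.differentiableWithinAt,
      by simp, ?_⟩
    refine ContDiffOn.congr ?_ fun w hw => (hasFDerivAt_jacobiThetaMoment j hw).fderiv
    exact ((contDiffOn_const.mul (ih (j + 1))).smul contDiffOn_const).add
      ((contDiffOn_const.mul (ih (j + 2))).smul contDiffOn_const)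

theorem contDiffOn_jacobiTheta₂ :
    ContDiffOn ℝ ∞ (fun w : ℂ × ℂ => jacobiTheta₂ w.1 w.2) {w : ℂ × ℂ | 0 < w.2.im} := by
  have h : (fun w : ℂ × ℂ => jacobiTheta₂ w.1 w.2) = jacobiThetaMoment 0 := by
    funext w; simp [jacobiThetaMoment, jacobiTheta₂]
  rw [h, contDiffOn_infty]
  exact fun N => (contDiffOn_jacobiThetaMoment N 0).restrict_scalars ℝ

theorem contDiffOn_thetaSeries {k : ℕ} (p : Fin k) :
    ContDiffOn ℝ ∞ (fun w : ℂ × ℂ => thetaSeries k p w.1 w.2) {w | 0 < w.2.im} := by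
  simp only [thetaSeries_eq]
  have he : ContDiff ℝ ∞ e := (differentiable_e.contDiff (n := ∞)).restrict_scalars ℝ
  refine ContDiffOn.mul (ContDiff.contDiffOn (he.comp (by fun_prop))) ?_
  refine contDiffOn_jacobiTheta₂.comp (f := fun w : ℂ × ℂ =>
    ((k * w.1 + (p : ℕ) * w.2 - k * w.2 / 2 : ℂ), (k * w.2 : ℂ))) ?_
    fun w hw => natCast_mul_im_pos p hw
  exact ContDiff.contDiffOn (by fun_prop)

theorem isThetaBasis_thetaSeries {k : ℕ} (hk : k ≠ 0) : IsThetaBasis k (thetaSeries k) where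
  linearIndependent _ hτ := linearIndependent_thetaSeries k hτ
  span_eq _ hτ := span_thetaSeries hk hτ
  contDiffOn := contDiffOn_thetaSeries
  periodic p z τ _ := thetaSeries_add_one p z τ

end Smoothness

/-! ### Topology of the Kodaira-Thurston manifold and of projective space -/

section Topology

theorem exists_zpow_apply_eq_gamFun {g : Equiv.Perm R4} {a : ℤ → ℤ × ℤ × ℤ × ℤ}
    (h0 : ∀ u, gamFun (a 0) u = u) (h : ∀ n u, g (gamFun (a n) u) = gamFun (a (n + 1)) u) (n : ℤ)
    (u : R4) : (g ^ n) u = gamFun (a n) u := by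
  induction n with
  | zero => simp [h0]
  | succ n ih => rw [add_comm, zpow_add, zpow_one, Equiv.Perm.mul_apply, ih, h, add_comm]
  | pred n ih =>
    have h1 := h (-n - 1) u
    rw [sub_add_cancel, ← ih] at h1
    rw [sub_eq_add_neg, add_comm, zpow_add, zpow_neg_one, Equiv.Perm.mul_apply,
      Equiv.Perm.inv_eq_iff_eq, add_comm, ← sub_eq_add_neg, h1]

theorem exists_gam_smul (q : ℤ × ℤ × ℤ × ℤ) : ∃ g : Gam, ∀ u : R4, g • u = gamFun q u := by
  obtain ⟨l, m, n, p⟩ := q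
  have hA : genA ∈ Gam := Subgroup.subset_closure (by simp)
  have hB : genB ∈ Gam := Subgroup.subset_closure (by simp)
  have hC : genC ∈ Gam := Subgroup.subset_closure (by simp)
  have hD : genD ∈ Gam := Subgroup.subset_closure (by simp)
  -- `genA` acts first, so that it shears by the original y rather than by y + m.
  refine ⟨⟨genD ^ p * (genC ^ n * (genB ^ m * genA ^ l)),
    mul_mem (zpow_mem hD p) (mul_mem (zpow_mem hC n) (mul_mem (zpow_mem hB m) (zpow_mem hA l)))⟩,
    fun u => ?_⟩
  change (genD ^ p) ((genC ^ n) ((genB ^ m) ((genA ^ l) u))) = _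
  rw [exists_zpow_apply_eq_gamFun (g := genA) (a := fun l => (l, 0, 0, 0)),
    exists_zpow_apply_eq_gamFun (g := genB) (a := fun l => (0, l, 0, 0)),
    exists_zpow_apply_eq_gamFun (g := genC) (a := fun l => (0, 0, l, 0)),
    exists_zpow_apply_eq_gamFun (g := genD) (a := fun l => (0, 0, 0, l))]
  · ext i; fin_cases i <;> simp [gamFun]; ring
  all_goals
    intros; ext i; fin_cases i <;> simp [gamFun, genA, genB, genC, genD] <;> ring

theorem proj_smul (g : Gam) (u : R4) : proj (g • u) = proj u :=
  Quotient.sound (MulAction.mem_orbit u g)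

theorem isQuotientMap_proj : Topology.IsQuotientMap proj := isQuotientMap_quotient_mk'

theorem continuous_proj : Continuous proj := isQuotientMap_proj.continuous

theorem surjective_proj : Function.Surjective proj := isQuotientMap_proj.surjective

instance instCompactSpaceMKT : CompactSpace MKT := by
  set K : Set R4 := (WithLp.toLp 2) '' Set.pi Set.univ (fun _ : Fin 4 => Set.Icc (0 : ℝ) 1) with hK
  have hKc : IsCompact K :=
    (isCompact_univ_pi fun _ => isCompact_Icc).image (PiLp.continuous_toLp 2 _)
  refine ⟨(hKc.image continuous_proj).of_isClosed_subset isClosed_univ fun m _ => ?_⟩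
  obtain ⟨u, rfl⟩ := surjective_proj m
  -- Reduction to the unit cube; the third exponent is the floor of z after the shear caused by
  -- reducing x.
  obtain ⟨g, hg⟩ := exists_gam_smul
    (-⌊u 0⌋, -⌊u 1⌋, -⌊u 2 + (-⌊u 0⌋ : ℤ) * u 1⌋, -⌊u 3⌋)
  refine ⟨g • u, ⟨(g • u).ofLp, fun i _ => ?_, rfl⟩, proj_smul g u⟩
  have hfl : ∀ x : ℝ, 0 ≤ x + (-⌊x⌋ : ℤ) ∧ x + (-⌊x⌋ : ℤ) ≤ 1 := fun x => by
    have h1 := Int.floor_le x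
    have h2 := Int.lt_floor_add_one x
    push_cast
    exact ⟨by linarith, by linarith⟩
  rw [hg]
  fin_cases i
  · exact hfl (u 0)
  · exact hfl (u 1)
  · have h := hfl (u 2 + (-⌊u 0⌋ : ℤ) * u 1)
    rw [add_right_comm] at h
    exact h
  · exact hfl (u 3)

/-- A line is sent to the matrix v v*/|v|² of its orthogonal projection, a continuous injection into
a Hausdorff space. -/
instance instT2SpaceCP (n : ℕ) : T2Space (CP n) := by
  set F : {v : Fin (n + 1) → ℂ // v ≠ 0} → (Fin (n + 1) → Fin (n + 1) → ℂ) := fun v i j =>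
    v.1 i * star (v.1 j) / ∑ l, v.1 l * star (v.1 l) with hF
  have hden : ∀ v : {v : Fin (n + 1) → ℂ // v ≠ 0}, ∑ l, v.1 l * star (v.1 l) ≠ 0 := fun v h => by
    have h' : v.1 ⬝ᵥ star v.1 = 0 := h
    open ComplexOrder in exact v.2 (dotProduct_self_star_eq_zero.1 h')
  have hinv : ∀ (a b : {v : Fin (n + 1) → ℂ // v ≠ 0}) (t : ℂ), a.1 = t • b.1 → F a = F b := by
    rintro ⟨a, ha⟩ ⟨b, hb⟩ t (h : a = t • b)
    have ht : t ≠ 0 := by rintro rfl; exact ha (by simpa using h)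
    have ht' : star t ≠ 0 := star_ne_zero.2 ht
    funext i j
    have h1 : ∑ l, (t • b) l * star ((t • b) l) = (t * star t) * ∑ l, b l * star (b l) := by
      rw [Finset.mul_sum]
      refine Finset.sum_congr rfl fun l _ => ?_
      simp only [Pi.smul_apply, smul_eq_mul, star_mul']; ring
    simp only [hF, h]
    rw [h1, Pi.smul_apply, Pi.smul_apply, smul_eq_mul, smul_eq_mul, star_mul',
      show t * b i * (star t * star (b j)) = (t * star t) * (b i * star (b j)) by ring,
      mul_div_mul_left _ _ (mul_ne_zero ht ht')]
  have hcont : Continuous F := by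
    have hc : ∀ i, Continuous fun v : {v : Fin (n + 1) → ℂ // v ≠ 0} => v.1 i := fun i =>
      (continuous_apply i).comp continuous_subtype_val
    exact continuous_pi fun i => continuous_pi fun j => ((hc i).mul (hc j).star).div
      (continuous_finsetSum _ fun l _ => (hc l).mul (hc l).star) hden
  refine T2Space.of_injective_continuous (f := (Projectivization.lift F hinv : CP n → _)) ?_
    ((isQuotientMap_mk' n).continuous_iff.2 hcont)
  intro p q h
  induction p using Projectivization.ind with
  | h v hv =>
  induction q using Projectivization.ind with
  | h w hw =>
  obtain ⟨j, hj⟩ := Function.ne_iff.1 hw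
  have hj' : star (w j) ≠ 0 := star_ne_zero.2 hj
  refine (Projectivization.mk_eq_mk_iff' ℂ _ _ _ _).2
    -- The scalar is read off by comparing the j-th columns of the two projection matrices, where w
    -- j ≠ 0.
    ⟨(∑ l, v l * star (v l)) / (∑ l, w l * star (w l)) * star (w j) / star (v j), ?_⟩
  have hvw : ∀ i, v i * star (v j) / ∑ l, v l * star (v l) =
      w i * star (w j) / ∑ l, w l * star (w l) := fun i => congrFun (congrFun h i) j
  have hv' := hden ⟨v, hv⟩
  have hw' := hden ⟨w, hw⟩
  simp only at hv' hw'
  have hvj : star (v j) ≠ 0 := fun h0 => by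
    have := hvw j
    rw [h0, mul_zero, zero_div, eq_comm, div_eq_zero_iff] at this
    exact this.elim (mul_ne_zero hj hj') hw'
  funext i
  have := hvw i
  rw [Pi.smul_apply, smul_eq_mul]
  rw [div_eq_div_iff hv' hw'] at this
  field_simp
  linear_combination -this

end Topology

/-! ### Maps from the Kodaira-Thurston manifold to projective space -/

section ProjectiveMaps

theorem chartAt_symm (m : MKT) : ((chartAt R4 m).symm : R4 → MKT) = proj := by
  have hloc := (isQuotientCoveringMap_quotientMk_of_properlyDiscontinuousSMul
    (E := R4) (G := Gam)).isCoveringMap.isLocalHomeomorph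
  change (((hloc.localInverseAt _).trans (chartAt R4 _)).symm : R4 → MKT) = proj
  rw [chartAt_self_eq, OpenPartialHomeomorph.trans_refl]
  exact hloc.localInverseAt_symm _

theorem proj_chartAt (m : MKT) : proj (chartAt R4 m m) = m := by
  rw [← chartAt_symm m]
  exact (chartAt R4 m).left_inv (mem_chart_source R4 m)

theorem exists_chartAt_eq {n : ℕ} (p : CP n) :
    ∃ i, p ∈ affineDomain i ∧ chartAt (Fin n → ℂ) p = affineChart i :=
  ⟨_, (exists_mem_affineDomain p).choose_spec, rfl⟩

variable {n : ℕ} {φ : MKT → CP n} {S : R4 → Fin (n + 1) → ℂ} (hS : ContDiff ℝ ∞ S)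
  (hne : ∀ u, S u ≠ 0) (hφ : ∀ u, φ (proj u) = Projectivization.mk ℂ (S u) (hne u))

include hS hφ in
theorem continuous_of_homogeneous : Continuous φ := by
  rw [isQuotientMap_proj.continuous_iff]
  have h : φ ∘ proj = fun u => Projectivization.mk' ℂ ⟨S u, hne u⟩ := funext hφ
  rw [h]
  exact (isQuotientMap_mk' n).continuous.comp (hS.continuous.subtype_mk _)

include hφ in
theorem exists_writtenInExtChartAt_eq (m : MKT) :
    ∃ i, S (chartAt R4 m m) i ≠ 0 ∧
      writtenInExtChartAt 𝓘(ℝ, R4) 𝓘(ℝ, Fin n → ℂ) m φ =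
        fun u j => S u (i.succAbove j) / S u i := by
  obtain ⟨i, hi, hchart⟩ := exists_chartAt_eq (φ m)
  refine ⟨i, ?_, ?_⟩
  · rw [← proj_chartAt m, hφ] at hi
    exact hi
  · funext u j
    simp only [writtenInExtChartAt, extChartAt, hchart, OpenPartialHomeomorph.extend_coe,
      OpenPartialHomeomorph.extend_coe_symm, Function.comp_apply, modelWithCornersSelf_coe,
      modelWithCornersSelf_coe_symm, chartAt_symm, id_eq, hφ]
    rfl

include hS in
theorem contDiffAt_div {u : R4} {i : Fin (n + 1)} (hi : S u i ≠ 0) :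
    ContDiffAt ℝ ∞ (fun u j => S u (i.succAbove j) / S u i) u := by
  refine contDiffAt_pi.2 fun j => ?_
  simp only [div_eq_mul_inv]
  have h := contDiff_pi.1 hS
  exact (h _).contDiffAt.mul ((h _).contDiffAt.inv hi)

include hS hφ in
theorem contMDiff_of_homogeneous : ContMDiff 𝓘(ℝ, R4) 𝓘(ℝ, Fin n → ℂ) ∞ φ := fun m => by
  rw [contMDiffAt_iff]
  refine ⟨(continuous_of_homogeneous hS hne hφ).continuousAt, ?_⟩
  obtain ⟨i, hi, hw⟩ := exists_writtenInExtChartAt_eq hne hφ m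
  change ContDiffWithinAt ℝ ∞ (writtenInExtChartAt 𝓘(ℝ, R4) 𝓘(ℝ, Fin n → ℂ) m φ) _ _
  rw [hw]
  exact (contDiffAt_div hS hi).contDiffWithinAt

include hS hφ in
/-- A tangent vector is in the kernel of the differential of `φ` only if the derivative of the
homogeneous coordinates in its direction is radial. -/
theorem exists_fderiv_eq_of_mfderiv_eq_zero (m : MKT) (v : R4)
    (hv : mfderiv 𝓘(ℝ, R4) 𝓘(ℝ, Fin n → ℂ) φ m v = 0) :
    ∃ (u : R4) (c : ℂ), ∀ i, fderiv ℝ (fun u => S u i) u v = c * S u i := by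
  obtain ⟨i, hi, hw⟩ := exists_writtenInExtChartAt_eq hne hφ m
  have hd := ((contMDiff_of_homogeneous hS hne hφ) m).mdifferentiableAt (by simp)
  have hv' : fderiv ℝ (fun u j => S u (i.succAbove j) / S u i) (chartAt R4 m m) v = 0 := by
    have h : mfderiv 𝓘(ℝ, R4) 𝓘(ℝ, Fin n → ℂ) φ m = fderiv ℝ
        (writtenInExtChartAt 𝓘(ℝ, R4) 𝓘(ℝ, Fin n → ℂ) m φ) (chartAt R4 m m) := by
      rw [← fderivWithin_univ, ← Set.range_id]
      exact hd.mfderiv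
    rw [← hw]
    exact (DFunLike.congr_fun h v).symm.trans hv
  set u₀ : R4 := chartAt R4 m m
  have hSd : ∀ l, DifferentiableAt ℝ (fun u => S u l) u₀ := fun l =>
    ((contDiff_pi.1 hS l).differentiable (by simp)) u₀
  have hq := (contDiffAt_div hS hi).differentiableAt (by simp)
  refine ⟨u₀, fderiv ℝ (fun u => S u i) u₀ v / S u₀ i, fun l => ?_⟩
  refine Fin.succAboveCases i ?_ (fun j => ?_) l
  · field_simp
  · have hqj : DifferentiableAt ℝ (fun u => S u (i.succAbove j) / S u i) u₀ :=
      differentiableAt_pi.1 hq j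
    have h0 : fderiv ℝ (fun u => S u (i.succAbove j) / S u i) u₀ v = 0 := by
      rw [fderiv_pi (differentiableAt_pi.1 hq)] at hv'
      exact congrFun hv' j
    -- The product rule for S_l = (S_l / S_i) · S_i: the ratio has zero derivative along v, so the
    -- derivative of S_l is S_l times the logarithmic derivative of S_i.
    have hev : (fun u => S u (i.succAbove j)) =ᶠ[𝓝 u₀]
        (fun u => S u (i.succAbove j) / S u i) * fun u => S u i := by
      filter_upwards [(hSd i).continuousAt.eventually_ne hi] with u hu
      simp [hu]
    rw [hev.fderiv_eq, fderiv_mul hqj (hSd i)]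
    simp [h0]
    ring

end ProjectiveMaps

/-! ### Theta functions on the Kodaira-Thurston manifold -/

section ThetaKT

open Complex

theorem add_I_im_pos (y : ℝ) : 0 < ((y : ℂ) + I).im := by simp

theorem I_im_pos : 0 < I.im := by simp

theorem contDiff_coord_add (i j : Fin 4) :
    ContDiff ℝ ∞ fun u : R4 => (u i : ℂ) + I * u j := by
  have h : ∀ l : Fin 4, ContDiff ℝ ∞ fun u : R4 => (u l : ℂ) := fun l =>
    ofRealCLM.contDiff.comp (by fun_prop : ContDiff ℝ ∞ fun u : R4 => u l)
  exact (h i).add (contDiff_const.mul (h j))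

theorem contDiff_coord_add_I (i : Fin 4) : ContDiff ℝ ∞ fun u : R4 => (u i : ℂ) + I :=
  (ofRealCLM.contDiff.comp (by fun_prop : ContDiff ℝ ∞ fun u : R4 => u i)).add contDiff_const

variable {k : ℕ} {θ : Fin k → ℂ → ℂ → ℂ}

theorem IsThetaBasis.mem_thetaSpace (hθ : IsThetaBasis k θ) (p : Fin k) {τ : ℂ} (hτ : 0 < τ.im) :
    (fun z => θ p z τ) ∈ thetaSpace k τ := by
  rw [← hθ.span_eq τ hτ]
  exact Submodule.subset_span ⟨p, rfl⟩

theorem IsThetaBasis.exists_sum_eq (hθ : IsThetaBasis k θ) {τ : ℂ} (hτ : 0 < τ.im) {f : ℂ → ℂ}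
    (hf : f ∈ thetaSpace k τ) : ∃ c : Fin k → ℂ, ∀ z, ∑ p, c p * θ p z τ = f z := by
  rw [← hθ.span_eq τ hτ, Submodule.mem_span_range_iff_exists_fun] at hf
  obtain ⟨c, hc⟩ := hf
  exact ⟨c, fun z => by simp [← hc]⟩

/-- A theta function at a fixed `τ₀` extends to all `τ`, and the product of the extension with a
theta function at `i` is a theta function on the Kodaira-Thurston manifold. -/
theorem IsThetaBasis.exists_extension (hθ : IsThetaBasis k θ) {τ₀ : ℂ} (hτ₀ : 0 < τ₀.im)
    {f g : ℂ → ℂ} (hf : f ∈ thetaSpace k τ₀) (hg : g ∈ thetaSpace k I) :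
    ∃ A : ℂ → ℂ → ℂ, (∀ z, A z τ₀ = f z) ∧
      ContDiffOn ℝ ∞ (fun w : ℂ × ℂ => A w.1 w.2) {w | 0 < w.2.im} ∧
      (fun u : R4 => A (u 2 + I * u 0) (u 1 + I) * g (u 1 + I * u 3)) ∈ thetaSpaceKT θ := by
  obtain ⟨c, hc⟩ := hθ.exists_sum_eq hτ₀ hf
  obtain ⟨d, hd⟩ := hθ.exists_sum_eq I_im_pos hg
  refine ⟨fun z τ => ∑ p, c p * θ p z τ, hc,
    ContDiffOn.sum fun p _ => contDiffOn_const.mul (hθ.contDiffOn p), ?_⟩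
  have h : (fun u : R4 => (∑ p, c p * θ p (u 2 + I * u 0) (u 1 + I)) * g (u 1 + I * u 3)) =
      ∑ p, ∑ q, (c p * d q) • thetaProd θ p q := by
    funext u
    simp only [← hd, Finset.sum_mul_sum, Finset.sum_apply, Pi.smul_apply, smul_eq_mul, thetaProd]
    exact Finset.sum_congr rfl fun p _ => Finset.sum_congr rfl fun q _ => by ring
  rw [h]
  exact Submodule.sum_mem _ fun p _ => Submodule.sum_mem _ fun q _ =>
    Submodule.smul_mem _ _ (Submodule.subset_span ⟨(p, q), rfl⟩)

theorem IsThetaBasis.exists_ne_zero (hθ : IsThetaBasis k θ) (hk : 3 ≤ k) (u : R4) :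
    ∃ s ∈ thetaSpaceKT θ, s u ≠ 0 := by
  obtain ⟨f, hf, hfu⟩ := exists_thetaSpace_ne_zero hk (add_I_im_pos (u 1)) (u 2 + I * u 0)
  obtain ⟨g, hg, hgu⟩ := exists_thetaSpace_ne_zero hk I_im_pos (u 1 + I * u 3)
  obtain ⟨A, hA, -, hmem⟩ := hθ.exists_extension (add_I_im_pos (u 1)) hf hg
  exact ⟨_, hmem, mul_ne_zero (by rwa [hA]) hgu⟩

theorem IsThetaBasis.contDiff_thetaProd (hθ : IsThetaBasis k θ) (p q : Fin k) :
    ContDiff ℝ ∞ (thetaProd θ p q) := by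
  refine ContDiff.mul ?_ ?_
  · exact (hθ.contDiffOn p).comp_contDiff ((contDiff_coord_add 2 0).prodMk (contDiff_coord_add_I 1))
      fun u => add_I_im_pos (u 1)
  · exact (hθ.contDiffOn q).comp_contDiff ((contDiff_coord_add 1 3).prodMk contDiff_const)
      fun u => I_im_pos

theorem IsThetaBasis.contDiff_of_mem (hθ : IsThetaBasis k θ) {s : R4 → ℂ}
    (hs : s ∈ thetaSpaceKT θ) : ContDiff ℝ ∞ s := by
  induction hs using Submodule.span_induction with
  | mem s hs => obtain ⟨⟨p, q⟩, rfl⟩ := hs; exact hθ.contDiff_thetaProd p q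
  | zero => exact contDiff_const
  | add s t _ _ hs ht => exact hs.add ht
  | smul c s _ hs => exact contDiff_const.mul hs

/-- For fixed y, t the points z + ix fill ℂ, so independence at τ = y + i kills the inner sums; then
y + it fills ℂ and independence at τ = i kills the coefficients. -/
theorem IsThetaBasis.linearIndependent_thetaProd (hθ : IsThetaBasis k θ) :
    LinearIndependent ℂ (fun pq : Fin k × Fin k => thetaProd θ pq.1 pq.2) := by
  rw [Fintype.linearIndependent_iff]
  intro c hc
  have h1 : ∀ (x y z t : ℝ), ∑ p, (∑ q, c (p, q) * θ q (y + I * t) I) *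
      θ p (z + I * x) (y + I) = 0 := by
    intro x y z t
    have := congrFun hc !₂[x, y, z, t]
    simp only [Fintype.sum_prod_type, Finset.sum_apply, Pi.smul_apply, smul_eq_mul, thetaProd,
      Pi.zero_apply] at this
    rw [← this]
    refine Finset.sum_congr rfl fun p _ => ?_
    rw [Finset.sum_mul]
    refine Finset.sum_congr rfl fun q _ => ?_
    simp
    ring
  have h2 : ∀ (y t : ℝ) p, ∑ q, c (p, q) * θ q (y + I * t) I = 0 := fun y t =>
    Fintype.linearIndependent_iff.1 (hθ.linearIndependent _ (add_I_im_pos y)) _ (by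
      funext w
      have := h1 w.im y w.re t
      rw [mul_comm I (w.im : ℂ), re_add_im] at this
      simpa using this)
  rintro ⟨p, q⟩
  exact Fintype.linearIndependent_iff.1 (hθ.linearIndependent _ I_im_pos) (fun q => c (p, q)) (by
    funext w
    have := h2 w.re w.im p
    rw [mul_comm I (w.im : ℂ), re_add_im] at this
    simpa using this) q

theorem IsThetaBasis.finrank_thetaSpaceKT (hθ : IsThetaBasis k θ) :
    Module.finrank ℂ (thetaSpaceKT θ) = k ^ 2 := by
  rw [thetaSpaceKT, finrank_span_eq_card hθ.linearIndependent_thetaProd]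
  simp [sq]

theorem exists_factor_of_thetaProd {g : Equiv.Perm R4}
    (h : ∀ u, ∃ c : ℂ, c ≠ 0 ∧ ∀ p q, thetaProd θ p q (g u) = c * thetaProd θ p q u) (u : R4) :
    ∃ c : ℂ, c ≠ 0 ∧ ∀ s ∈ thetaSpaceKT θ, s (g u) = c * s u := by
  obtain ⟨c, hc, hg⟩ := h u
  refine ⟨c, hc, fun s hs => ?_⟩
  induction hs using Submodule.span_induction with
  | mem s hs => obtain ⟨⟨p, q⟩, rfl⟩ := hs; exact hg p q
  | zero => simp
  | add s t _ _ hs ht => simp [hs, ht, mul_add]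
  | smul a s _ hs => simp [hs, mul_left_comm]

/-- On generators: `genA` sends w to w + τ, `genC` sends w to w + 1, `genD` sends v to v + i, and
`genB` sends τ to τ + 1 and v to v + 1. The resulting factor does not depend on p, q. -/
theorem IsThetaBasis.exists_factor (hθ : IsThetaBasis k θ) {g : Equiv.Perm R4} (hg : g ∈ Gam)
    (u : R4) : ∃ c : ℂ, c ≠ 0 ∧ ∀ s ∈ thetaSpaceKT θ, s (g u) = c * s u := by
  induction hg using Subgroup.closure_induction generalizing u with
  | mem g hg =>
    refine exists_factor_of_thetaProd (fun u => ?_) u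
    rcases hg with rfl | rfl | rfl | rfl
    · refine ⟨_, exp_ne_zero (-2 * Real.pi * I * k * (u 2 + I * u 0)), fun p q => ?_⟩
      have h1 := (hθ.mem_thetaSpace p (add_I_im_pos (u 1))).2.2 (u 2 + I * u 0)
      simp only [thetaProd, genA, Equiv.coe_fn_mk]
      rw [← mul_assoc, ← h1]
      simp
      ring_nf
      simp
    · refine ⟨1, one_ne_zero, fun p q => ?_⟩
      have h1 := hθ.periodic p (u 2 + I * u 0) _ (add_I_im_pos (u 1))
      have h2 := (hθ.mem_thetaSpace q I_im_pos).2.1 (u 1 + I * u 3)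
      beta_reduce at h2
      simp only [thetaProd, genB, Equiv.coe_fn_mk]
      rw [one_mul, ← h1, ← h2]
      simp
      ring_nf
    · refine ⟨1, one_ne_zero, fun p q => ?_⟩
      have h1 := (hθ.mem_thetaSpace p (add_I_im_pos (u 1))).2.1 (u 2 + I * u 0)
      beta_reduce at h1
      simp only [thetaProd, genC, Equiv.coe_fn_mk]
      rw [one_mul, ← h1]
      simp
      ring_nf
      simp
    · refine ⟨_, exp_ne_zero (-2 * Real.pi * I * k * (u 1 + I * u 3)), fun p q => ?_⟩
      have h1 := (hθ.mem_thetaSpace q I_im_pos).2.2 (u 1 + I * u 3)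
      simp only [thetaProd, genD, Equiv.coe_fn_mk]
      rw [mul_left_comm, ← h1]
      simp
      ring_nf
      simp
  | one => exact ⟨1, one_ne_zero, by simp⟩
  | mul g h _ _ hg hh =>
    obtain ⟨c, hc, hs⟩ := hh u
    obtain ⟨d, hd, ht⟩ := hg (h u)
    exact ⟨d * c, mul_ne_zero hd hc, fun s hsm => by
      rw [Equiv.Perm.mul_apply, ht s hsm, hs s hsm, mul_assoc]⟩
  | inv g _ hg =>
    obtain ⟨c, hc, hs⟩ := hg (g⁻¹ u)
    refine ⟨c⁻¹, inv_ne_zero hc, fun s hsm => ?_⟩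
    have h := hs s hsm
    rw [show g (g⁻¹ u) = u from g.apply_symm_apply u] at h
    rw [h, inv_mul_cancel_left₀ hc]

/-- At two points where the theta functions are proportional, `y` and `t` differ by integers. -/
theorem IsThetaBasis.exists_int_add_of_proportional (hθ : IsThetaBasis k θ) (hk : 3 ≤ k)
    {u u' : R4} {c : ℂ} (hc : ∀ s ∈ thetaSpaceKT θ, s u' = c * s u) :
    ∃ m n : ℤ, u' 1 = u 1 + m ∧ u' 3 = u 3 + n := by
  by_cases hv : ∃ m n : ℤ, (u' 1 + I * u' 3 : ℂ) - (u 1 + I * u 3) = m + n * I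
  · obtain ⟨m, n, h⟩ := hv
    have h1 := congrArg re h
    have h2 := congrArg im h
    simp at h1 h2
    exact ⟨m, n, by linarith, by linarith⟩
  · exfalso
    obtain ⟨g, hg, hgu, hgu'⟩ := exists_thetaSpace_separating hk I_im_pos hv
    obtain ⟨f, hf, hfu⟩ := exists_thetaSpace_ne_zero hk (add_I_im_pos (u' 1)) (u' 2 + I * u' 0)
    obtain ⟨A, hA, -, hmem⟩ := hθ.exists_extension (add_I_im_pos (u' 1)) hf hg
    have h := hc _ hmem
    simp only [hgu, mul_zero, hA] at h
    exact mul_ne_zero hfu hgu' h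

theorem IsThetaBasis.exists_gamFun_eq_of_proportional (hθ : IsThetaBasis k θ) (hk : 3 ≤ k)
    {u u' : R4} {c : ℂ} (hc : ∀ s ∈ thetaSpaceKT θ, s u' = c * s u) (h1 : u' 1 = u 1)
    (h3 : u' 3 = u 3) : ∃ q, u' = gamFun q u := by
  by_cases hv : ∃ m n : ℤ, (u' 2 + I * u' 0 : ℂ) - (u 2 + I * u 0) = m + n * (u 1 + I)
  · obtain ⟨m, n, h⟩ := hv
    have hre := congrArg re h
    have him := congrArg im h
    simp at hre him
    -- Translation of w by m + nτ is the action of the n-th power of `genA` and the m-th power of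
    -- `genC`.
    refine ⟨(n, 0, m, 0), ?_⟩
    ext i
    fin_cases i
    · simp [gamFun]; linarith
    · simpa [gamFun] using h1
    · simp [gamFun]; linarith
    · simpa [gamFun] using h3
  · exfalso
    obtain ⟨f, hf, hfu, hfu'⟩ := exists_thetaSpace_separating hk (add_I_im_pos (u 1)) hv
    obtain ⟨g, hg, hgu⟩ := exists_thetaSpace_ne_zero hk I_im_pos (u 1 + I * u 3)
    obtain ⟨A, hA, -, hmem⟩ := hθ.exists_extension (add_I_im_pos (u 1)) hf hg
    have h := hc _ hmem
    simp only [h1, h3, hA, hfu, zero_mul, mul_zero] at h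
    exact mul_ne_zero hfu' hgu h

/-- Γ first aligns y and t, changing the proportionality constant by a nonzero factor; both points
then lie over the same τ. -/
theorem IsThetaBasis.proj_eq_of_proportional (hθ : IsThetaBasis k θ) (hk : 3 ≤ k) {u u' : R4}
    {c : ℂ} (hc : ∀ s ∈ thetaSpaceKT θ, s u' = c * s u) : proj u' = proj u := by
  obtain ⟨m, n, h1, h3⟩ := hθ.exists_int_add_of_proportional hk hc
  obtain ⟨g, hg⟩ := exists_gam_smul (0, m, 0, n)
  obtain ⟨d, hd, hgu⟩ := hθ.exists_factor g.2 u
  have hgu' : ∀ s ∈ thetaSpaceKT θ, s (g • u) = d * s u := hgu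
  obtain ⟨q, hq⟩ := hθ.exists_gamFun_eq_of_proportional hk (u := g • u) (u' := u') (c := c * d⁻¹)
    (fun s hs => by rw [hc s hs, hgu' s hs]; field_simp)
    (by rw [hg, h1]; simp [gamFun]) (by rw [hg, h3]; simp [gamFun])
  obtain ⟨g', hg'⟩ := exists_gam_smul q
  rw [hq, ← hg', proj_smul, proj_smul]

theorem hasDerivAt_coord_line (u v : R4) (i j : Fin 4) :
    HasDerivAt (fun r : ℝ => (((u + r • v) i : ℝ) : ℂ) + I * ((u + r • v) j : ℝ))
      (v i + I * v j) 0 := by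
  have h : ∀ l : Fin 4, HasDerivAt (fun r : ℝ => (((u + r • v) l : ℝ) : ℂ)) (v l) 0 := fun l => by
    have := ((hasDerivAt_id (0 : ℝ)).mul_const (v l)).const_add (u l)
    simpa using this.ofReal_comp
  exact (h i).add ((h j).const_mul I)

theorem hasDerivAt_comp_coord_line {f : ℂ → ℂ} (hf : Differentiable ℂ f) (u v : R4)
    (i j : Fin 4) :
    HasDerivAt (fun r : ℝ => f ((((u + r • v) i : ℝ) : ℂ) + I * ((u + r • v) j : ℝ)))
      (deriv f (u i + I * u j) * (v i + I * v j)) 0 := by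
  have h := (hf (u i + I * u j)).hasDerivAt
  exact HasDerivAt.comp_of_eq (0 : ℝ) h (hasDerivAt_coord_line u v i j) (by simp)

theorem coord_eq_zero {v : R4} {i j : Fin 4} (h : (v i + I * v j : ℂ) = 0) :
    v i = 0 ∧ v j = 0 := by
  have h1 := congrArg re h
  have h2 := congrArg im h
  simp at h1 h2
  exact ⟨h1, h2⟩

theorem IsThetaBasis.hasDerivAt_line (hθ : IsThetaBasis k θ) {s : R4 → ℂ}
    (hs : s ∈ thetaSpaceKT θ) (u v : R4) :
    HasDerivAt (fun r : ℝ => s (u + r • v)) (fderiv ℝ s u v) 0 :=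
  (((hθ.contDiff_of_mem hs).differentiable (by simp)) u).hasFDerivAt.hasLineDerivAt v

/-- The theta functions of degree `k ≥ 3` separate tangent vectors. -/
theorem IsThetaBasis.eq_zero_of_fderiv_proportional (hθ : IsThetaBasis k θ) (hk : 3 ≤ k)
    {u v : R4} {c : ℂ} (hc : ∀ s ∈ thetaSpaceKT θ, fderiv ℝ s u v = c * s u) : v = 0 := by
  have h13 : v 1 = 0 ∧ v 3 = 0 := by
    obtain ⟨g, hg, hgu, hgu'⟩ := exists_thetaSpace_deriv_ne_zero hk I_im_pos (u 1 + I * u 3)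
    obtain ⟨f, hf, hfu⟩ := exists_thetaSpace_ne_zero hk (add_I_im_pos (u 1)) (u 2 + I * u 0)
    obtain ⟨A, hA, hAd, hmem⟩ := hθ.exists_extension (add_I_im_pos (u 1)) hf hg
    have h := hc _ hmem
    simp only [hgu, mul_zero] at h
    have hd := hθ.hasDerivAt_line hmem u v
    rw [h] at hd
    have hA' : ContDiff ℝ ∞ fun u : R4 => A (u 2 + I * u 0) (u 1 + I) :=
      hAd.comp_contDiff ((contDiff_coord_add 2 0).prodMk (contDiff_coord_add_I 1))
        fun u => add_I_im_pos (u 1)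
    have hA'' := ((hA'.differentiable (by simp)) u).hasFDerivAt.hasLineDerivAt v
    have hprod := HasDerivAt.mul hA'' (hasDerivAt_comp_coord_line hg.1 u v 1 3)
    have heq := hd.unique hprod
    -- As g vanishes at v, the unknown derivative of A drops out of the product rule, leaving f(w)
    -- g'(v) times the base component of the tangent vector.
    simp only [zero_smul, add_zero, hgu, mul_zero, zero_add, hA] at heq
    rcases mul_eq_zero.1 heq.symm with h0 | h0
    · exact absurd h0 hfu
    · exact coord_eq_zero ((mul_eq_zero.1 h0).resolve_left hgu')
  have h20 : v 2 = 0 ∧ v 0 = 0 := by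
    obtain ⟨f, hf, hfu, hfu'⟩ :=
      exists_thetaSpace_deriv_ne_zero hk (add_I_im_pos (u 1)) (u 2 + I * u 0)
    obtain ⟨g, hg, hgu⟩ := exists_thetaSpace_ne_zero hk I_im_pos (u 1 + I * u 3)
    obtain ⟨A, hA, -, hmem⟩ := hθ.exists_extension (add_I_im_pos (u 1)) hf hg
    have h := hc _ hmem
    simp only [hA, hfu, zero_mul, mul_zero] at h
    have hd := hθ.hasDerivAt_line hmem u v
    rw [h] at hd
    -- With the base components zero, τ is constant along the line, so A may be replaced by the
    -- entire function f.
    have hline : ∀ r : ℝ, (u + r • v) 1 = u 1 ∧ (u + r • v) 3 = u 3 := fun r => by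
      simp [h13.1, h13.2]
    simp only [(hline _).1, (hline _).2, hA] at hd
    have heq := hd.unique ((hasDerivAt_comp_coord_line hf.1 u v 2 0).mul_const _)
    exact coord_eq_zero (((mul_eq_zero.1 ((mul_eq_zero.1 heq.symm).resolve_right hgu))).resolve_left
      hfu')
  ext i
  fin_cases i
  · exact h20.2
  · exact h13.1
  · exact h20.1
  · exact h13.2

end ThetaKT

/-! ### The projective embedding defined by a basis -/

section Embedding

variable {k : ℕ} {θ : Fin k → ℂ → ℂ → ℂ}

theorem forall_mem_of_basis {ι : Type*} {L : Submodule ℂ (R4 → ℂ)} (s : Module.Basis ι ℂ L)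
    {P : (R4 → ℂ) → Prop} (h0 : P 0) (hadd : ∀ f ∈ L, ∀ g ∈ L, P f → P g → P (f + g))
    (hsmul : ∀ (c : ℂ), ∀ f ∈ L, P f → P (c • f)) (hs : ∀ i, P (s i)) : ∀ f ∈ L, P f := by
  intro f hf
  have hspan : (⟨f, hf⟩ : L) ∈ Submodule.span ℂ (Set.range s) := s.span_eq ▸ Submodule.mem_top
  suffices ∀ x : L, x ∈ Submodule.span ℂ (Set.range s) → P x from this ⟨f, hf⟩ hspan
  intro x hx
  induction hx using Submodule.span_induction with
  | mem x hx => obtain ⟨i, rfl⟩ := hx; exact hs i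
  | zero => exact h0
  | add x y _ _ hx hy => exact hadd _ x.2 _ y.2 hx hy
  | smul c x _ hx => exact hsmul c _ x.2 hx

theorem eq_mul_of_basis {ι : Type*} {L : Submodule ℂ (R4 → ℂ)} (s : Module.Basis ι ℂ L)
    {u u' : R4} {c : ℂ} (h : ∀ i, (s i : R4 → ℂ) u' = c * (s i : R4 → ℂ) u) :
    ∀ f ∈ L, f u' = c * f u :=
  forall_mem_of_basis s (by simp) (fun f _ g _ hf hg => by simp [hf, hg, mul_add])
    (fun a f _ hf => by simp [hf, mul_left_comm]) h

theorem IsThetaBasis.fderiv_eq_mul_of_basis (hθ : IsThetaBasis k θ) {ι : Type*}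
    (s : Module.Basis ι ℂ (thetaSpaceKT θ)) {u v : R4} {c : ℂ}
    (h : ∀ i, fderiv ℝ (s i : R4 → ℂ) u v = c * (s i : R4 → ℂ) u) :
    ∀ f ∈ thetaSpaceKT θ, fderiv ℝ f u v = c * f u := by
  have hd : ∀ f ∈ thetaSpaceKT θ, DifferentiableAt ℝ f u := fun f hf =>
    ((hθ.contDiff_of_mem hf).differentiable (by simp)) u
  refine forall_mem_of_basis s (P := fun f => fderiv ℝ f u v = c * f u) (by simp)
    (fun f hf' g hg' hf hg => ?_) (fun a f hf' hf => ?_) h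
  · rw [fderiv_add (hd f hf') (hd g hg')]
    simp [hf, hg, mul_add]
  · rw [fderiv_const_smul (hd f hf')]
    simp [hf, mul_left_comm]

/-- A basis of the theta functions of degree `k ≥ 3` embeds the Kodaira-Thurston manifold. -/
theorem IsThetaBasis.exists_embedding (hθ : IsThetaBasis k θ) (hk : 3 ≤ k) {n : ℕ}
    (s : Module.Basis (Fin (n + 1)) ℂ (thetaSpaceKT θ)) :
    ∃ φ : MKT → CP n,
      (∀ u : R4, ∃ h : (fun i => (s i : R4 → ℂ) u) ≠ 0,
        φ (proj u) = Projectivization.mk ℂ (fun i => (s i : R4 → ℂ) u) h) ∧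
      ContMDiff 𝓘(ℝ, R4) 𝓘(ℝ, Fin n → ℂ) ∞ φ ∧
      Topology.IsEmbedding φ ∧
      ∀ m : MKT, Function.Injective (mfderiv 𝓘(ℝ, R4) 𝓘(ℝ, Fin n → ℂ) φ m) := by
  have hne : ∀ u : R4, (fun i => (s i : R4 → ℂ) u) ≠ 0 := fun u h => by
    obtain ⟨f, hf, hfu⟩ := hθ.exists_ne_zero hk u
    refine hfu ?_
    -- Proportionality with u' = u and c = 0 says that a common zero of the basis is a zero of the
    -- whole space.
    rw [eq_mul_of_basis s (u := u) (u' := u) (c := 0) (fun i => by simpa using congrFun h i) f hf,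
      zero_mul]
  have hinv : ∀ u u' : R4, (MulAction.orbitRel Gam R4) u u' →
      Projectivization.mk ℂ (fun i => (s i : R4 → ℂ) u) (hne u) =
        Projectivization.mk ℂ (fun i => (s i : R4 → ℂ) u') (hne u') := by
    rintro u u' ⟨g, rfl⟩
    obtain ⟨c, -, hc⟩ := hθ.exists_factor g.2 u'
    exact (Projectivization.mk_eq_mk_iff' ℂ _ _ _ _).2
      ⟨c, funext fun i => (hc _ (s i).2).symm⟩
  set φ : MKT → CP n := Quotient.lift _ hinv
  have hφ : ∀ u, φ (proj u) = Projectivization.mk ℂ (fun i => (s i : R4 → ℂ) u) (hne u) :=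
    fun u => rfl
  have hS : ContDiff ℝ ∞ fun (u : R4) i => (s i : R4 → ℂ) u :=
    contDiff_pi.2 fun i => hθ.contDiff_of_mem (s i).2
  have hsmooth := contMDiff_of_homogeneous hS hne hφ
  have hinj : Function.Injective φ := by
    intro m m' h
    obtain ⟨u, rfl⟩ := surjective_proj m
    obtain ⟨u', rfl⟩ := surjective_proj m'
    rw [hφ, hφ, Projectivization.mk_eq_mk_iff'] at h
    obtain ⟨c, hc⟩ := h
    exact hθ.proj_eq_of_proportional hk
      (eq_mul_of_basis s (c := c) fun i => (congrFun hc i).symm)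
  refine ⟨φ, fun u => ⟨hne u, hφ u⟩, hsmooth,
    (hsmooth.continuous.isClosedEmbedding hinj).isEmbedding, fun m => ?_⟩
  refine (injective_iff_map_eq_zero _).2 fun v hv => ?_
  obtain ⟨u, c, hc⟩ := exists_fderiv_eq_of_mfderiv_eq_zero hS hne hφ m v hv
  exact hθ.eq_zero_of_fderiv_proportional hk (hθ.fderiv_eq_mul_of_basis s hc)

end Embedding

end KodairaThurston

-- As k ≥ 3, the truncated subtraction is harmless and k ^ 2 - 1 + 1 = k ^ 2; this form matches the
-- index type of the homogeneous coordinates of `CP (k ^ 2 - 1)`.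
open KodairaThurston in
theorem theorem1 (k : ℕ) (hk : 3 ≤ k) :
    IsThetaBasis k (thetaSeries k) ∧
    ∀ θ : Fin k → ℂ → ℂ → ℂ, IsThetaBasis k θ →
      Module.finrank ℂ (thetaSpaceKT θ) = k ^ 2 ∧
      ∀ s : Module.Basis (Fin (k ^ 2 - 1 + 1)) ℂ (thetaSpaceKT θ),
        ∃ φ : MKT → CP (k ^ 2 - 1),
          (∀ u : R4, ∃ h : (fun i => (s i : R4 → ℂ) u) ≠ 0,
            φ (proj u) = Projectivization.mk ℂ (fun i => (s i : R4 → ℂ) u) h) ∧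
          ContMDiff 𝓘(ℝ, R4) 𝓘(ℝ, Fin (k ^ 2 - 1) → ℂ) ∞ φ ∧
          Topology.IsEmbedding φ ∧
          ∀ m : MKT, Function.Injective
            (mfderiv 𝓘(ℝ, R4) 𝓘(ℝ, Fin (k ^ 2 - 1) → ℂ) φ m) :=
  ⟨isThetaBasis_thetaSeries (by omega), fun _ hθ =>
    ⟨hθ.finrank_thetaSpaceKT, fun s => hθ.exists_embedding hk s⟩⟩
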